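/- **Setting.** Consider an $[[n,k]]$ stabilizer code given by $n-k$ commuting independent stabilizer generators (each $\pm$ a tensor product of Pauli operators), with distance $d\ge 5$ (the minimum weight of a Pauli operator that commutes with all generators but is, up to phase, not in the stabilizer group), and let $t=\lfloor (d-1)/2\rfloor$. In each round of full syndrome measurement all generators are measured one after the other by Shor syndrome extraction circuits: for a generator of weight $w$, prepare a $w$-qubit cat state $(|0\dots0\rangle+|1\dots1\rangle)/\sqrt2$, apply $w$ transversal controlled-Pauli gates, apply Hadamard gates to the ancilla qubits, measure them in the $Z$ basis, and take the parity of the results (corrected by the sign of the generator). Faults: an arbitrary two-qubit Pauli error after a controlled-Pauli gate, an arbitrary one-qubit Pauli error after a one-qubit gate (including the Pauli gates of the final correction), a bit flip of a measurement result, and, the cat states being prepared fault-tolerantly, a Pauli error on a cat state, which counts as as many faults as its weight. Error correction using a syndrome $\vec\sigma$ means applying a Pauli operator of minimum weight among those with syndrome $\vec\sigma$. Let $\vec s_i$ be the syndrome obtained in round $i$. The difference vector after $m$ rounds is $\vec\delta=\delta_1\cdots\delta_{m-1}$ with $\delta_i=0$ if $\vec s_{i+1}=\vec s_i$ and $\delta_i=1$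 otherwise. For a bit string, let $\mu$ be the number of non-overlapping substrings $11$ plus the number of remaining ones. A maximal zero substring $\eta$ of length $\gamma>0$ of a bit string $\vec\delta'$ is *usable for $t_{\rm in}$* if $\alpha+\beta+\gamma\ge t_{\rm in}$, where $\alpha$ (resp. $\beta$) is the value of $\mu$ on the part of $\vec\delta'$ before (resp. after) $\eta$ with the one adjacent to $\eta$ removed ($0$ if that part is empty). **The adaptive weak protocol.** Put $t_{\rm in}=t-1$ and $\vec\delta'=\delta_2\cdots\delta_{m-1}$ if $\vec s_1\ne0$, and $t_{\rm in}=t$ and $\vec\delta'=0\,\delta_1\cdots\delta_{m-1}$ if $\vec s_1=0$. Repeat rounds of full syndrome measurement until (a) $\vec\delta'$ contains a zero substring usable for $t_{\rm in}$; then perform error correction using the syndrome corresponding to any zero of such a substring (a zero $\delta_i$ corresponds to $\vec s_i=\vec s_{i+1}$, and the added zero to $\vec s_1=0$); or (b) the number of non-overlapping substrings $11$ in $\vec\delta'$ is $t_{\rm in}$; then perform error correction using the syndrome of the latest round. **Theorem.** This protocol is weakly $t$-fault tolerant, that is, whenever the input is a codeword with a Pauli error of weight $r$, and $s$ faults occur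 during the protocol, with $r+s\le t$: 1. ideally decoding the output state gives the same codeword as ideally decoding the input state; 2. the output state differs from some valid codeword by an error of weight at most $s$. Moreover, the following numbers of rounds are sufficient, i.e. the protocol always stops after at most this many rounds, whatever syndromes are observed: - if $\vec s_1\ne 0$: $\left(\frac{t+2}{2}\right)^2$ rounds for $t$ even, and $\left(\frac{t+1}{2}\right)\left(\frac{t+3}{2}\right)$ rounds for $t$ odd; - if $\vec s_1=0$: $\left(\frac{t+2}{2}\right)\left(\frac{t+4}{2}\right)-2$ rounds for $t$ even, and $\left(\frac{t+3}{2}\right)^2-2$ rounds for $t$ odd. -/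

import Mathlib

namespace ShorEC

open scoped Matrix

/-! ### Qubits, states and Pauli operators -/

/-- A single-qubit Pauli operator modulo phase, in the binary representation `(x, z)`:
`(0,0) = I`, `(1,0) = X`, `(0,1) = Z`, `(1,1) = Y`. -/
abbrev Pauli : Type := ZMod 2 × ZMod 2

/-- An `n`-qubit Pauli operator modulo phase (qubits indexed by `Q`).  Addition is multiplication
modulo phase, and `hammingNorm` is the weight. -/
abbrev PauliString (Q : Type) : Type := Q → Pauli

/-- (Not necessarily normalised) pure states of a register with qubits `Q`, given by their
amplitudes in the computational basis. -/
abbrev QState (Q : Type) : Type := (Q → ZMod 2) → ℂ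

/-- Linear operators on the register `Q`. -/
abbrev QOp (Q : Type) : Type := Matrix (Q → ZMod 2) (Q → ZMod 2) ℂ

/-- The `2 × 2` Hermitian Pauli matrix: `i ^ (x z) X ^ x Z ^ z`. -/
noncomputable def pauliMat (p : Pauli) : Matrix (ZMod 2) (ZMod 2) ℂ :=
  Matrix.of fun b a =>
    if b = a + p.1 then Complex.I ^ (p.1.val * p.2.val) * (-1) ^ (p.2.val * a.val) else 0

/-- The `2 × 2` Hadamard matrix. -/
noncomputable def hadamardMat : Matrix (ZMod 2) (ZMod 2) ℂ :=
  Matrix.of fun b a => (-1) ^ (b.val * a.val) / ((Real.sqrt 2 : ℝ) : ℂ)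

/-- The tensor product of single-qubit operators. -/
def tensorOp {Q : Type} [Fintype Q] (U : Q → Matrix (ZMod 2) (ZMod 2) ℂ) : QOp Q :=
  Matrix.of fun b a => ∏ q, U q (b q) (a q)

/-- The Hermitian `n`-qubit Pauli operator `P₁ ⊗ P₂ ⊗ ⋯`. -/
noncomputable def pauliOp {Q : Type} [Fintype Q] (p : PauliString Q) : QOp Q :=
  tensorOp fun q => pauliMat (p q)

/-- The controlled-`P` gate with control qubit `c` and target qubit `q`. -/
noncomputable def controlledPauli {Q : Type} [Fintype Q] [DecidableEq Q] (c q : Q) (P : Pauli) :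
    QOp Q :=
  Matrix.of fun b a =>
    if b c = 0 then (1 : QOp Q) b a else pauliOp (Pi.single q P : PauliString Q) b a

/-- The symplectic form; it is `0` iff the two Pauli operators commute and `1` iff they
anticommute. -/
def symplectic {Q : Type} [Fintype Q] (p p' : PauliString Q) : ZMod 2 :=
  ∑ q, ((p q).1 * (p' q).2 + (p q).2 * (p' q).1)

/-! ### Stabilizer codes -/

/-- A stabilizer code on `n` qubits given by `l` (that is, `l = n - k`) commuting independent
stabilizer generators; the `j`-th one is `(-1) ^ sign j` times the Pauli operator `gen j`. -/
structure StabilizerCode (n l : ℕ) where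
  gen : Fin l → PauliString (Fin n)
  sign : Fin l → ZMod 2
  commuting : ∀ i j, symplectic (gen i) (gen j) = 0
  independent : LinearIndependent (ZMod 2) gen

/-- Error syndromes: one bit for each generator. -/
abbrev Syndrome (l : ℕ) : Type := Fin l → ZMod 2

variable {n l : ℕ}

/-- Valid codewords: nonzero vectors in the simultaneous `+1` eigenspace of the generators. -/
def IsCodeword (C : StabilizerCode n l) (c : QState (Fin n)) : Prop :=
  c ≠ 0 ∧ ∀ j, ((-1 : ℂ) ^ (C.sign j).val • pauliOp (C.gen j)) *ᵥ c = c

/-- The syndrome of a Pauli error: which generators it anticommutes with. -/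
def syndromeOf (C : StabilizerCode n l) (E : PauliString (Fin n)) : Syndrome l :=
  fun j => symplectic (C.gen j) E

/-- Nontrivial logical operators: Pauli operators that commute with every generator but are not
in the stabilizer group (modulo phase). -/
def IsNontrivialLogical (C : StabilizerCode n l) (E : PauliString (Fin n)) : Prop :=
  syndromeOf C E = 0 ∧ E ∉ Submodule.span (ZMod 2) (Set.range C.gen)

/-- The code distance: the minimum weight of a nontrivial logical operator. -/
noncomputable def distance (C : StabilizerCode n l) : ℕ :=
  sInf {w | ∃ E, IsNontrivialLogical C E ∧ hammingNorm E = w}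

/-- `R` is an error correction operator for the syndrome `σ`: a Pauli operator of minimum weight
among those with syndrome `σ`. -/
def IsRecovery (C : StabilizerCode n l) (σ : Syndrome l) (R : PauliString (Fin n)) : Prop :=
  syndromeOf C R = σ ∧ ∀ R', syndromeOf C R' = σ → hammingNorm R ≤ hammingNorm R'

/-- The projector onto the joint eigenspace of the generators with eigenvalues `(-1) ^ σ j`. -/
noncomputable def syndromeProjector (C : StabilizerCode n l) (σ : Syndrome l) : QOp (Fin n) :=
  (List.ofFn fun j =>
    (1 / 2 : ℂ) • (1 + (-1 : ℂ) ^ (C.sign j + σ j).val • pauliOp (C.gen j))).prod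

/-- Ideal (fault-free) decoding of a state: an ideal measurement of all the generators, which
yields some syndrome of nonzero probability, followed by an error correction operator for it. -/
def IdeallyDecodesTo (C : StabilizerCode n l) (ψ φ : QState (Fin n)) : Prop :=
  ∃ σ R, IsRecovery C σ R ∧ φ = pauliOp R *ᵥ (syndromeProjector C σ *ᵥ ψ) ∧ φ ≠ 0

/-! ### Shor syndrome extraction circuits with faults -/

/-- The data qubits on which `g` acts nontrivially.  They also index the ancilla qubits of the
cat state used for measuring `g`. -/
abbrev Supp (g : PauliString (Fin n)) : Type := {q : Fin n // g q ≠ 0}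

/-- The faults in one measurement of the operator `g` by the Shor circuit:
* `prep`: the error on the cat state after its (fault-tolerant) preparation;
* `gate`: the two-qubit Pauli error (on the ancilla qubit, on the data qubit) after each
  controlled Pauli gate;
* `had`: the Pauli error after each Hadamard gate;
* `flip`: the bit flip of the result of each single-qubit measurement. -/
structure GenFault (g : PauliString (Fin n)) where
  prep : Supp g → Pauli
  gate : Supp g → Pauli × Pauli
  had : Supp g → Pauli
  flip : Supp g → ZMod 2

/-- The number of faults.  The cat state is prepared fault-tolerantly, so that an error of
weight `w` on it takes `w` faults. -/
def GenFault.count {g : PauliString (Fin n)} (F : GenFault g) : ℕ :=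
  hammingNorm F.prep + hammingNorm F.gate + hammingNorm F.had + hammingNorm F.flip

/-- The cat state `(|0…0⟩ + |1…1⟩) / √2`. -/
noncomputable def catState (A : Type) [Fintype A] : QState A := fun b =>
  ((if ∀ a, b a = 0 then 1 else 0) + (if ∀ a, b a = 1 then 1 else 0)) / ((Real.sqrt 2 : ℝ) : ℂ)

/-- The joint state of data and ancilla qubits just before the ancilla measurements of the Shor
circuit for `g`, when `ψ` is the state of the data qubits before the circuit: the cat state is
prepared, the controlled Pauli gates are applied one after the other (ancilla qubit as control,
the corresponding data qubit as target), and Hadamard gates are applied to all ancilla qubits.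
Each step is followed by its faults. -/
noncomputable def shorCircuit (g : PauliString (Fin n)) (F : GenFault g) (ψ : QState (Fin n)) :
    QState (Fin n ⊕ Supp g) :=
  let ψ₀ : QState (Fin n ⊕ Supp g) :=
    pauliOp (Sum.elim 0 F.prep) *ᵥ
      fun b => ψ (fun q => b (Sum.inl q)) * catState (Supp g) (fun a => b (Sum.inr a))
  let ψ₁ : QState (Fin n ⊕ Supp g) :=
    ((Finset.univ : Finset (Supp g)).sort (· ≤ ·)).foldl
      (fun φ a =>
        pauliOp (Sum.elim (Pi.single a.1 (F.gate a).2) (Pi.single a (F.gate a).1)) *ᵥ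
          (controlledPauli (Sum.inr a) (Sum.inl a.1) (g a.1) *ᵥ φ))
      ψ₀
  pauliOp (Sum.elim 0 F.had) *ᵥ (tensorOp (Sum.elim (fun _ => 1) fun _ => hadamardMat) *ᵥ ψ₁)

/-- Measuring the `j`-th generator with faults `F` on the data state `ψ` can yield the syndrome
bit `s` and the (unnormalised) data state `ψ'`: for some outcome `m` of nonzero probability of the
`Z`-basis measurement of the ancilla qubits, `ψ'` is the corresponding post-measurement state of
the data qubits and `s` is the parity of the recorded results, corrected by the sign of the
generator. -/
def GenMeasurement (C : StabilizerCode n l) (j : Fin l) (F : GenFault (C.gen j))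
    (ψ : QState (Fin n)) (s : ZMod 2) (ψ' : QState (Fin n)) : Prop :=
  ∃ m : Supp (C.gen j) → ZMod 2,
    (ψ' = fun b => shorCircuit (C.gen j) F ψ (Sum.elim b m)) ∧ ψ' ≠ 0 ∧
    s = ∑ a, (m a + F.flip a) + C.sign j

/-- The faults in one round of full syndrome measurement. -/
abbrev RoundFault (C : StabilizerCode n l) : Type := (j : Fin l) → GenFault (C.gen j)

/-- One round of full syndrome measurement: all the generators are measured sequentially. -/
def FullMeasurement (C : StabilizerCode n l) (F : RoundFault C)
    (ψ : QState (Fin n)) (s : Syndrome l) (ψ' : QState (Fin n)) : Prop :=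
  ∃ φ : Fin (l + 1) → QState (Fin n), φ 0 = ψ ∧ φ (Fin.last l) = ψ' ∧
    ∀ j : Fin l, GenMeasurement C j (F j) (φ j.castSucc) (s j) (φ j.succ)

/-! ### Adaptive protocols and their executions -/

/-- An adaptive rule: `rule h σ` says that after the rounds with syndromes `h` (in order) the
measurements can be stopped with `σ` as the syndrome for error correction. -/
abbrev AdaptiveRule (l : ℕ) : Type := List (Syndrome l) → Syndrome l → Prop

/-- The syndromes of the first `m` rounds; `s i` belongs to round number `i + 1`. -/
def history (s : ℕ → Syndrome l) (m : ℕ) : List (Syndrome l) := (List.range m).map s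

/-- The rule stops after the rounds with syndromes `h`. -/
def Stops (rule : AdaptiveRule l) (h : List (Syndrome l)) : Prop := ∃ σ, rule h σ

/-- The rule stops after at most `M` rounds when the syndromes of successive rounds are `s`. -/
def StopsWithin (rule : AdaptiveRule l) (s : ℕ → Syndrome l) (M : ℕ) : Prop :=
  ∃ m, 1 ≤ m ∧ m ≤ M ∧ Stops rule (history s m)

/-- A complete execution of the error correction protocol given by an adaptive rule: rounds of
full syndrome measurement are performed until the rule stops, and then an error correction
operator for the chosen syndrome is applied by single-qubit Pauli gates, each of which may be
followed by a Pauli error. -/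
structure Execution (C : StabilizerCode n l) (rule : AdaptiveRule l) where
  rounds : ℕ
  fault : ℕ → RoundFault C
  state : ℕ → QState (Fin n)
  syn : ℕ → Syndrome l
  measured : ∀ i < rounds, FullMeasurement C (fault i) (state i) (syn i) (state (i + 1))
  not_stopped : ∀ m < rounds, ¬ Stops rule (history syn m)
  chosen : Syndrome l
  stopped : rule (history syn rounds) chosen
  recovery : PauliString (Fin n)
  isRecovery : IsRecovery C chosen recovery
  recoveryFault : PauliString (Fin n)
  recoveryFault_subset : ∀ q, recoveryFault q ≠ 0 → recovery q ≠ 0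

/-- The input state. -/
def Execution.input {C : StabilizerCode n l} {rule : AdaptiveRule l} (e : Execution C rule) :
    QState (Fin n) :=
  e.state 0

/-- The output state. -/
noncomputable def Execution.output {C : StabilizerCode n l} {rule : AdaptiveRule l}
    (e : Execution C rule) : QState (Fin n) :=
  pauliOp e.recoveryFault *ᵥ (pauliOp e.recovery *ᵥ e.state e.rounds)

/-- The total number of faults that occur during the execution. -/
def Execution.numFaults {C : StabilizerCode n l} {rule : AdaptiveRule l} (e : Execution C rule) :
    ℕ :=
  (∑ i ∈ Finset.range e.rounds, ∑ j, (e.fault i j).count) + hammingNorm e.recoveryFault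

/-- Error correction correctness property (for `r + s ≤ t`): ideally decoding the output state
gives the same codeword (up to a scalar) as ideally decoding the input state. -/
def ECCP (C : StabilizerCode n l) (rule : AdaptiveRule l) (t : ℕ) : Prop :=
  ∀ (e : Execution C rule) (c : QState (Fin n)) (E : PauliString (Fin n)),
    IsCodeword C c → e.input = pauliOp E *ᵥ c → hammingNorm E + e.numFaults ≤ t →
    ∀ φ φ', IdeallyDecodesTo C e.input φ → IdeallyDecodesTo C e.output φ' →
      ∃ a : ℂ, a ≠ 0 ∧ φ' = a • φ

/-- Weak error correction recovery property (for `r + s ≤ t`): the output state differs from a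
valid codeword by an error of weight at most `s`. -/
def weakECRP (C : StabilizerCode n l) (rule : AdaptiveRule l) (t : ℕ) : Prop :=
  ∀ (e : Execution C rule) (c : QState (Fin n)) (E : PauliString (Fin n)),
    IsCodeword C c → e.input = pauliOp E *ᵥ c → hammingNorm E + e.numFaults ≤ t →
    ∃ (c' : QState (Fin n)) (E' : PauliString (Fin n)), IsCodeword C c' ∧
      hammingNorm E' ≤ e.numFaults ∧ e.output = pauliOp E' *ᵥ c'

/-- Weak `t`-fault tolerance. -/
def WeaklyFaultTolerant (C : StabilizerCode n l) (rule : AdaptiveRule l) (t : ℕ) : Prop :=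
  ECCP C rule t ∧ weakECRP C rule t

/-! ### The adaptive weak decoder -/

/-- The difference vector; `true` is a one (different successive syndromes), `false` a zero. -/
def diffVector (h : List (Syndrome l)) : List Bool :=
  List.zipWith (fun s s' => decide (s' ≠ s)) h h.tail

/-- The total number of non-overlapping substrings `11`. -/
def numPairs : List Bool → ℕ
  | true :: true :: w => numPairs w + 1
  | _ :: w => numPairs w
  | [] => 0

/-- The number of non-overlapping substrings `11` plus the number of remaining ones. -/
def minFaults (w : List Bool) : ℕ := numPairs w + (w.count true - 2 * numPairs w)

/-- `δ` has the form `u 0…0 v` with exactly `γ > 0` zeros shown, which form a maximal zero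
substring, and this zero substring is usable for the fault number `t`, that is, `α + β + γ ≥ t`.
Here `α` and `β` are computed from the parts before and after the substring, with the ones
adjacent to it (if any) removed. -/
def UsableZeros (t : ℕ) (δ u : List Bool) (γ : ℕ) (v : List Bool) : Prop :=
  δ = u ++ List.replicate γ false ++ v ∧ 0 < γ ∧
  (u = [] ∨ ∃ u', u = u' ++ [true]) ∧ (v = [] ∨ ∃ v', v = true :: v') ∧
  t ≤ minFaults u.dropLast + minFaults v.tail + γ

/-- The rule of the adaptive weak decoder.  Positions in lists are counted from `0`.
If the first syndrome is nonzero, position `p` of `δ.tail` is the comparison of `h[p+1]` and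
`h[p+2]`.  If it is zero, position `p` of `0 δ` is the comparison of `h[p-1]` and `h[p]`, or, for
`p = 0`, of the zero syndrome and `h[0]`. -/
def weakRule (l t : ℕ) : AdaptiveRule l := fun h σ =>
  (∃ s₁ ∈ h.head?, s₁ ≠ 0 ∧
    ((∃ u γ v p, UsableZeros (t - 1) (diffVector h).tail u γ v ∧
        u.length ≤ p ∧ p < u.length + γ ∧ h[p + 1]? = some σ) ∨
      (numPairs (diffVector h).tail = t - 1 ∧ h.getLast? = some σ))) ∨
  (∃ s₁ ∈ h.head?, s₁ = 0 ∧
    ((∃ u γ v p, UsableZeros t (false :: diffVector h) u γ v ∧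
        u.length ≤ p ∧ p < u.length + γ ∧ h[p]? = some σ) ∨
      (numPairs (false :: diffVector h) = t ∧ h.getLast? = some σ)))

end ShorEC

namespace ShorEC

open scoped Matrix

variable {n l : ℕ}

/-! ### Counting non-overlapping pairs of ones -/

/-! The proof reduces the quantum circuits to classical bookkeeping of Pauli errors, and then counts
faults in bit strings.

Circuits. A codeword with a Pauli error is an eigenvector of every generator `g`. In the Shor
circuit the two branches of the cat state leave data errors `D` and `D + g`, which act on such an
eigenvector in the same way up to a scalar. So every measurement outcome leaves a codeword with a
Pauli error, changed by an operator of weight at most the number of faults. Without faults, the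
amplitude vanishes unless the parity shows the eigenvalue (`shorCircuit_of_eigenstate`). An
execution therefore has a sequence of errors; each round changes the error by at most its number of
faults, and a faultless round reports the true syndrome (`Execution.exists_errors`).

Choice of the syndrome. A one in the difference vector forces a fault in one of the two rounds
compared, so a string `w` forces `minFaults w` faults. If all `γ + 1` rounds of a usable zero
substring were faulty, there would be at least `α + β + γ + 1` faults, exceeding the budget; so one
of them is faultless and its correct syndrome is shared by the whole substring
(`exists_faultless_of_usable`). When the number of substrings `11` first reaches the budget, all the
faults have already occurred before the last round (`last_faultless_of_numPairs`). The budget is `t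
- 1` if the first syndrome is nonzero, since that already costs an input error or a fault; otherwise
the input error is counted as the faults of a fictitious round with syndrome zero. Correcting with a
syndrome that was true at some time leaves, modulo stabilizers, only the faults after that time
(`Execution.output_of_chosen_eq`).

Number of rounds. In a string with `m` zero runs, none usable for `T`, each zero run is bounded in
terms of the runs of ones. Summing gives length at most `m * (T + 3 - m) - 3` for `m ≥ 2`, hence at
most `(T + 3) ^ 2 / 4 - 3` (`length_lt_of_not_usableZeros`). -/

@[simp] theorem numPairs_nil : numPairs [] = 0 := by simp [numPairs]

@[simp] theorem numPairs_true_true (w : List Bool) :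
    numPairs (true :: true :: w) = numPairs w + 1 := by simp [numPairs]

@[simp] theorem numPairs_false (w : List Bool) : numPairs (false :: w) = numPairs w := by
  simp [numPairs]

@[simp] theorem numPairs_true_nil : numPairs [true] = 0 := by simp [numPairs]

@[simp] theorem numPairs_true_false (w : List Bool) :
    numPairs (true :: false :: w) = numPairs w := by simp [numPairs]

/-- Induction on bit strings along the greedy search for substrings `11`. -/
theorem pair_induction {P : List Bool → Prop} (nil : P []) (one : P [true])
    (zero : ∀ w, P w → P (false :: w)) (oneZero : ∀ w, P w → P (true :: false :: w))
    (oneOne : ∀ w, P w → P (true :: true :: w)) : ∀ w, P w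
  | [] => nil
  | [true] => one
  | false :: w => zero w (pair_induction nil one zero oneZero oneOne w)
  | true :: false :: w => oneZero w (pair_induction nil one zero oneZero oneOne w)
  | true :: true :: w => oneOne w (pair_induction nil one zero oneZero oneOne w)

theorem two_mul_numPairs_le (w : List Bool) : 2 * numPairs w ≤ w.count true := by
  induction w using pair_induction <;> simp <;> omega

theorem minFaults_add_numPairs (w : List Bool) :
    minFaults w + numPairs w = w.count true := by
  have := two_mul_numPairs_le w
  unfold minFaults; omega

theorem numPairs_append_false (x y : List Bool) :
    numPairs (x ++ false :: y) = numPairs x + numPairs y := by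
  induction x using pair_induction <;> simp_all
  omega

theorem minFaults_append_false (x y : List Bool) :
    minFaults (x ++ false :: y) = minFaults x + minFaults y := by
  have h1 := minFaults_add_numPairs (x ++ false :: y)
  have h2 := minFaults_add_numPairs x
  have h3 := minFaults_add_numPairs y
  rw [numPairs_append_false] at h1
  simp at h1
  omega

@[simp] theorem minFaults_nil : minFaults [] = 0 := by simp [minFaults]

theorem minFaults_false (w : List Bool) : minFaults (false :: w) = minFaults w := by
  simpa using minFaults_append_false [] w

theorem minFaults_replicate_false (k : ℕ) (w : List Bool) :
    minFaults (List.replicate k false ++ w) = minFaults w := by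
  induction k with
  | zero => simp
  | succ k ih => rw [List.replicate_succ, List.cons_append, minFaults_false, ih]

theorem numPairs_replicate_true : ∀ k, numPairs (List.replicate k true) = k / 2
  | 0 => by simp
  | 1 => by simp
  | k + 2 => by simp [List.replicate_succ, numPairs_replicate_true k]

theorem minFaults_replicate_true (k : ℕ) : minFaults (List.replicate k true) = (k + 1) / 2 := by
  have h := minFaults_add_numPairs (List.replicate k true)
  rw [numPairs_replicate_true] at h
  simp at h; omega

/-- One further round raises the count by at most one, and only if the new comparison is a one; so
the count cannot skip the stopping value. -/
theorem numPairs_concat (w : List Bool) (b : Bool) :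
    numPairs (w ++ [b]) = numPairs w ∨ (numPairs (w ++ [b]) = numPairs w + 1 ∧ b = true) := by
  induction w using pair_induction <;> cases b <;> simp_all

/-- If every one of `w` is between two positions at least one of which is marked by `g`, then the
total mark is at least `minFaults w`. -/
theorem minFaults_le_sum (w : List Bool) : ∀ g : ℕ → ℕ,
    (∀ i, w[i]? = some true → 1 ≤ g i + g (i + 1)) →
    minFaults w ≤ ∑ i ∈ Finset.range (w.length + 1), g i := by
  induction w using pair_induction with
  | nil => simp
  | one =>
    intro g h
    have := h 0 (by simp)
    simp [Finset.sum_range_succ, minFaults] at *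
    omega
  | zero w ih =>
    intro g h
    rw [minFaults_false, List.length_cons, Finset.sum_range_succ']
    have := ih (fun i => g (i + 1)) fun i hi => h (i + 1) (by simpa using hi)
    omega
  | oneZero w ih =>
    intro g h
    -- The block `10` is charged to the marks at 0 and 1. The rest of the string uses the marks from
    -- 2 on, so nothing is charged twice; the same works for `11`.
    have h1 := ih (fun i => g (i + 2)) fun i hi => h (i + 2) (by simpa using hi)
    have h0 := h 0 (by simp)
    have h2 := minFaults_add_numPairs (true :: false :: w)
    have h3 := minFaults_add_numPairs w
    simp at h2
    rw [List.length_cons, List.length_cons, Finset.sum_range_succ', Finset.sum_range_succ']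
    simp only [add_assoc, Nat.reduceAdd] at *
    omega
  | oneOne w ih =>
    intro g h
    have h1 := ih (fun i => g (i + 2)) fun i hi => h (i + 2) (by simpa using hi)
    have h0 := h 0 (by simp)
    have h2 := minFaults_add_numPairs (true :: true :: w)
    have h3 := minFaults_add_numPairs w
    simp at h2
    rw [List.length_cons, List.length_cons, Finset.sum_range_succ', Finset.sum_range_succ']
    simp only [add_assoc, Nat.reduceAdd] at *
    omega

/-! ### Difference strings -/

/-- The string of the comparisons of the first `N + 1` terms of a sequence. -/
def diffString {α : Type*} [DecidableEq α] (S : ℕ → α) (N : ℕ) : List Bool :=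
  (List.range N).map fun p => decide (S (p + 1) ≠ S p)

section diffString

variable {α : Type*} [DecidableEq α] (S : ℕ → α) (N : ℕ)

@[simp] theorem length_diffString : (diffString S N).length = N := by simp [diffString]

theorem diffString_succ :
    diffString S (N + 1) = diffString S N ++ [decide (S (N + 1) ≠ S N)] := by
  simp [diffString, List.range_succ]

theorem getElem?_diffString_eq_true {p : ℕ} (h : (diffString S N)[p]? = some true) :
    S (p + 1) ≠ S p := by
  simp only [diffString, List.getElem?_map, Option.map_eq_some_iff] at h
  obtain ⟨a, ha, h⟩ := h
  obtain ⟨_, rfl⟩ := List.getElem?_eq_some_iff.1 ha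
  simpa using h

theorem getElem?_diffString_eq_false {p : ℕ} (h : (diffString S N)[p]? = some false) :
    S (p + 1) = S p := by
  simp only [diffString, List.getElem?_map, Option.map_eq_some_iff] at h
  obtain ⟨a, ha, h⟩ := h
  obtain ⟨_, rfl⟩ := List.getElem?_eq_some_iff.1 ha
  simpa using h

theorem numPairs_diffString_lt {T : ℕ} (hT : 0 < T)
    (h : ∀ k ≤ N, numPairs (diffString S k) ≠ T) : numPairs (diffString S N) < T := by
  induction N with
  | zero => simpa [diffString] using hT
  | succ N ih =>
    have h1 := ih fun k hk => h k (by omega)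
    have h2 := h (N + 1) le_rfl
    rw [diffString_succ] at *
    rcases numPairs_concat (diffString S N) (decide (S (N + 1) ≠ S N)) with h3 | ⟨h3, -⟩ <;> omega

end diffString

/-! ### Locating a faultless round

Here `S` is the sequence of the observed syndromes, `good` that of the true ones, and `g` counts
the faults. -/

section locate

variable {α : Type*} [DecidableEq α] {S good : ℕ → α} {g : ℕ → ℕ} {N T : ℕ}

/-- Two consecutive faultless rounds report the same true syndrome. -/
theorem one_le_of_diffString (hg : ∀ j, j ≤ N → g j = 0 → S j = good j ∧ good (j + 1) = good j)
    {p : ℕ} (hp : (diffString S N)[p]? = some true) : 1 ≤ g p + g (p + 1) := by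
  by_contra h
  have hlt : p < N := by
    have := (List.getElem?_eq_some_iff.1 hp).1
    simpa using this
  have h1 := hg p (by omega) (by omega)
  have h2 := hg (p + 1) (by omega) (by omega)
  exact getElem?_diffString_eq_true S N hp (by rw [h2.1, h1.2, h1.1])

/-- A zero run of length `γ` joins `γ + 1` rounds. The ones adjacent to it are discarded because the
faults causing them may lie in these rounds; what remains on either side concerns disjoint sets of
rounds, so the three fault counts add up. -/
theorem exists_faultless_of_usable
    (hg : ∀ j, j ≤ N → g j = 0 → S j = good j ∧ good (j + 1) = good j)
    (hsum : ∑ j ∈ Finset.range (N + 1), g j ≤ T) {u v : List Bool} {γ p : ℕ}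
    (h : UsableZeros T (diffString S N) u γ v) (hp : u.length ≤ p) (hp' : p < u.length + γ) :
    S (p + 1) = S p ∧ ∃ j ≤ N, S p = good j := by
  obtain ⟨hw, hγ, hu, hv, hT⟩ := h
  have hN : N = u.length + γ + v.length := by
    have := congrArg List.length hw
    simpa [add_assoc] using this
  have hzero : ∀ i, u.length ≤ i → i < u.length + γ → S (i + 1) = S i := by
    intro i hi hi'
    apply getElem?_diffString_eq_false S N
    rw [hw, List.append_assoc, List.getElem?_append_right hi, List.getElem?_append_left (by simp; omega)]
    rw [List.getElem?_replicate]; simp; omega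
  have hconst : ∀ i, i ≤ γ → S (u.length + i) = S u.length := by
    intro i
    induction i with
    | zero => simp
    | succ i ih =>
      intro hi
      rw [← add_assoc, hzero (u.length + i) (by omega) (by omega), ih (by omega)]
  refine ⟨hzero p hp hp', ?_⟩
  by_cases hex : ∃ i ≤ γ, g (u.length + i) = 0
  · obtain ⟨i, hi, hi0⟩ := hex
    refine ⟨u.length + i, by omega, ?_⟩
    rw [← (hg _ (by omega) hi0).1, hconst i hi]
    obtain ⟨q, rfl⟩ := Nat.exists_eq_add_of_le hp
    exact hconst q (by omega)
  · exfalso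
    push Not at hex
    -- Without its last one, `u` compares only rounds `0` to `u.length - 1`, which lie before the
    -- zero run.
    have hα : minFaults u.dropLast ≤ ∑ i ∈ Finset.range u.length, g i := by
      rcases hu with rfl | ⟨u', rfl⟩
      · simp
      · have := minFaults_le_sum u' g fun i hi => by
          apply one_le_of_diffString hg
          have hi' := (List.getElem?_eq_some_iff.1 hi).1
          rw [hw, List.append_assoc, List.append_assoc, List.getElem?_append_left hi', hi]
        simpa using this
    have hβ : minFaults v.tail ≤ ∑ i ∈ Finset.range v.length, g (u.length + γ + 1 + i) := by
      rcases hv with rfl | ⟨v', rfl⟩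
      · simp
      · have := minFaults_le_sum v' (fun i => g (u.length + γ + 1 + i)) fun i hi => by
          apply one_le_of_diffString hg
          have : u.length + γ + 1 + i = (u ++ List.replicate γ false).length + (i + 1) := by
            simp; omega
          rw [hw, this, List.getElem?_append_right (by omega)]
          simpa using hi
        simpa using this
    have hmid : γ + 1 ≤ ∑ i ∈ Finset.range (γ + 1), g (u.length + i) := by
      have := Finset.card_nsmul_le_sum (Finset.range (γ + 1)) (fun i => g (u.length + i)) 1
        fun i hi => Nat.one_le_iff_ne_zero.2 (hex i (by simp at hi; omega))
      simpa using this
    have hsplit : N + 1 = u.length + (γ + 1) + v.length := by omega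
    rw [hsplit, Finset.sum_range_add, Finset.sum_range_add] at hsum
    simp only [← add_assoc] at hsum hmid
    omega

/-- The last comparison completes the `T`-th substring `11`. Before it there were `T - 1` pairs and
at least `2 * T - 1` ones, which already force `T` faults among the earlier rounds. -/
theorem last_faultless_of_numPairs
    (hg : ∀ j, j ≤ N + 1 → g j = 0 → S j = good j ∧ good (j + 1) = good j)
    (hsum : ∑ j ∈ Finset.range (N + 2), g j ≤ T)
    (h : numPairs (diffString S (N + 1)) = T) (h' : numPairs (diffString S N) ≠ T) :
    S (N + 1) = good (N + 1) := by
  refine (hg _ le_rfl ?_).1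
  rw [diffString_succ] at h
  rcases numPairs_concat (diffString S N) (decide (S (N + 1) ≠ S N)) with h3 | ⟨h3, hb⟩
  · omega
  have h1 := two_mul_numPairs_le (diffString S N ++ [decide (S (N + 1) ≠ S N)])
  rw [hb] at h h1 h3
  simp only [List.count_append, List.count_singleton_self] at h1
  have h2 := minFaults_add_numPairs (diffString S N)
  have h4 := minFaults_le_sum (diffString S N) g fun i hi =>
    one_le_of_diffString (fun j hj => hg j (by omega)) hi
  rw [length_diffString] at h4
  rw [Finset.sum_range_succ] at hsum
  omega

end locate

/-! ### Strings without usable zeros are short -/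

/-- The string `1…1 0…0 1…1 ⋯` with run lengths `k` and those in the list of blocks. -/
def ofRuns (k : ℕ) (L : List (ℕ × ℕ)) : List Bool :=
  List.replicate k true ++
    L.flatMap fun b => List.replicate b.1 false ++ List.replicate b.2 true

/-- All the run lengths are positive, except possibly the last one. -/
def ProperRuns : List (ℕ × ℕ) → Prop
  | [] => True
  | b :: L => 0 < b.1 ∧ (L = [] ∨ 0 < b.2) ∧ ProperRuns L

theorem exists_ofRuns (w : List Bool) : ∃ k L, ProperRuns L ∧ w = ofRuns k L := by
  induction w with
  | nil => exact ⟨0, [], by simp [ProperRuns], by simp [ofRuns]⟩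
  | cons b w ih =>
    obtain ⟨k, L, hL, rfl⟩ := ih
    cases b with
    | true => exact ⟨k + 1, L, hL, by simp [ofRuns, List.replicate_succ]⟩
    | false =>
      rcases k with _ | k
      · rcases L with _ | ⟨⟨c, k⟩, L⟩
        · exact ⟨0, [(1, 0)], by simp [ProperRuns], by simp [ofRuns]⟩
        · exact ⟨0, (c + 1, k) :: L, by simpa [ProperRuns] using hL.2,
            by simp [ofRuns, List.replicate_succ]⟩
      · exact ⟨0, (1, k + 1) :: L, by simpa [ProperRuns] using hL,
          by simp [ofRuns]⟩

/-- The value of `minFaults` on `ofRuns 0 L`. -/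
def runFaults (L : List (ℕ × ℕ)) : ℕ := (L.map fun b => (b.2 + 1) / 2).sum

theorem ofRuns_cons (k c k' : ℕ) (L : List (ℕ × ℕ)) :
    ofRuns k ((c, k') :: L) = List.replicate k true ++ (List.replicate c false ++ ofRuns k' L) := by
  simp [ofRuns]

theorem minFaults_ofRuns {L : List (ℕ × ℕ)} (hL : ProperRuns L) (k : ℕ) :
    minFaults (ofRuns k L) = (k + 1) / 2 + runFaults L := by
  induction L generalizing k with
  | nil => simp [ofRuns, runFaults, minFaults_replicate_true]
  | cons b L ih =>
    obtain ⟨c, k'⟩ := b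
    obtain ⟨hc, -, hL⟩ := hL
    obtain ⟨c, rfl⟩ := Nat.exists_eq_add_of_lt hc
    have : 0 + c + 1 = c + 1 := by omega
    rw [ofRuns_cons, this, List.replicate_succ, List.cons_append, minFaults_append_false,
      minFaults_replicate_false, ih hL, minFaults_replicate_true]
    simp [runFaults]

/-- No zero run of `ofRuns k L` is usable for `T`, if the string before it contributes `A`. -/
def NoUsableRuns (T A k : ℕ) : List (ℕ × ℕ) → Prop
  | [] => True
  | b :: L => A + k / 2 + (b.2 / 2 + runFaults L) + b.1 < T ∧
      NoUsableRuns T (A + (k + 1) / 2) b.2 L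

/-- Here `x` is the part already scanned. It is empty or ends in a zero, so `minFaults` is additive
across its end; an empty run of ones (`k = 0`) can occur in front of a zero run only at the very
start. -/
theorem noUsableRuns_of_not_usableZeros {T : ℕ} {w : List Bool}
    (hw : ∀ u γ v, ¬ UsableZeros T w u γ v) (L : List (ℕ × ℕ)) :
    ∀ (k : ℕ) (x : List Bool), ProperRuns L → (x = [] ∨ 0 < k ∧ ∃ x', x = x' ++ [false]) →
      w = x ++ ofRuns k L → NoUsableRuns T (minFaults x) k L := by
  induction L with
  | nil => intros; trivial
  | cons b L ih =>
    obtain ⟨c, k'⟩ := b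
    rintro k x ⟨hc, hk', hL⟩ hx rfl
    simp only at hc hk'
    have hxr : ∀ j, minFaults (x ++ List.replicate j true) = minFaults x + (j + 1) / 2 := by
      intro j
      rcases hx with rfl | ⟨-, x', rfl⟩
      · simp [minFaults_replicate_true]
      · rw [List.append_assoc, List.singleton_append, minFaults_append_false,
          minFaults_append_false, minFaults_replicate_true, minFaults_nil, add_zero]
    constructor
    · by_contra hcon
      refine hw (x ++ List.replicate k true) c (ofRuns k' L) ⟨by simp [ofRuns_cons], hc, ?_, ?_, ?_⟩
      · rcases k with _ | k
        · left
          rcases hx with rfl | ⟨h, -⟩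
          · simp
          · omega
        · right
          exact ⟨x ++ List.replicate k true, by simp [List.replicate_succ']⟩
      · rcases k' with _ | k'
        · left
          rcases hk' with rfl | h
          · simp [ofRuns]
          · omega
        · right
          exact ⟨ofRuns k' L, by simp [ofRuns, List.replicate_succ]⟩
      · have h1 : (x ++ List.replicate k true).dropLast = x ++ List.replicate (k - 1) true := by
          rcases k with _ | k
          · rcases hx with rfl | ⟨h, -⟩
            · simp
            · omega
          · rw [List.replicate_succ', ← List.append_assoc, List.dropLast_concat]; simp
        have h2 : (ofRuns k' L).tail = ofRuns (k' - 1) L := by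
          rcases k' with _ | k'
          · rcases hk' with rfl | h
            · simp [ofRuns]
            · omega
          · simp [ofRuns, List.replicate_succ]
        rw [h1, h2, hxr, minFaults_ofRuns hL]
        simp only at hcon
        omega
    · rcases hk' with rfl | hk'
      · trivial
      have h0 : minFaults (x ++ List.replicate k true ++ List.replicate c false) =
          minFaults x + (k + 1) / 2 := by
        obtain ⟨c, rfl⟩ := Nat.exists_eq_add_of_lt hc
        have := minFaults_replicate_false c []
        rw [List.append_nil] at this
        rw [show 0 + c + 1 = c + 1 by omega, List.replicate_succ, minFaults_append_false, this, hxr]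
        simp
      rw [← h0]
      refine ih k' _ hL (Or.inr ⟨hk', x ++ List.replicate k true ++ List.replicate (c - 1) false, ?_⟩) ?_
      · obtain ⟨c, rfl⟩ := Nat.exists_eq_add_of_lt hc
        simp [List.replicate_succ']
      · simp [ofRuns_cons]

/-- Let `μ` be the total of the rounded-up halves of the runs of ones. A zero run has length at most
`T - 1 - μ` plus one for each neighbouring run of ones that is odd. An odd run is also one shorter
than twice its rounded-up half. Hence parity costs nothing for the two outer runs and at most one
for each of the `L.length - 1` inner runs. The value `μ` does not change along the recursion, which
moves runs from the tail into `A`. -/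
theorem length_le_of_noUsableRuns {T : ℕ} (L : List (ℕ × ℕ)) : ∀ (A k : ℕ) (μ : ℤ), L ≠ [] →
    NoUsableRuns T A k L → μ = A + ((k + 1) / 2 : ℕ) + runFaults L →
    ((ofRuns k L).length : ℤ) ≤
      L.length * (T - 1 - μ) + 2 * (((k + 1) / 2 : ℕ) + runFaults L) + (L.length - 1) := by
  induction L with
  | nil => intro _ _ _ h; exact absurd rfl h
  | cons b L ih =>
    obtain ⟨c, k'⟩ := b
    rintro A k μ - ⟨h1, h2⟩ hμ
    simp only at h1 h2
    have hr : runFaults ((c, k') :: L) = (k' + 1) / 2 + runFaults L := by simp [runFaults]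
    have hlen : (ofRuns k ((c, k') :: L)).length = k + (c + (ofRuns k' L).length) := by
      simp [ofRuns_cons]
    rcases eq_or_ne L [] with rfl | hL
    · simp [ofRuns, runFaults] at *
      omega
    · have h3 := ih _ _ μ hL h2 (by rw [hμ, hr]; push_cast; ring)
      rw [hlen, hr]
      push_cast [List.length_cons] at *
      have : ((L.length : ℤ) + 1) * (T - 1 - μ) = L.length * (T - 1 - μ) + (T - 1 - μ) := by ring
      rw [this]
      omega

/-- Every run of ones except possibly the last is nonempty and contributes at least one. -/
theorem length_pred_le_runFaults {L : List (ℕ × ℕ)} (hL : ProperRuns L) :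
    L.length ≤ runFaults L + 1 := by
  induction L with
  | nil => simp
  | cons b L ih =>
    have h1 := ih hL.2.2
    have hr : runFaults (b :: L) = (b.2 + 1) / 2 + runFaults L := by simp [runFaults]
    rcases hL.2.1 with rfl | h2
    · simp
    · rw [hr, List.length_cons]; omega

/-- A string without zeros usable for `T` and with fewer than `T` substrings `11` is short. -/
theorem length_lt_of_not_usableZeros {T : ℕ} {w : List Bool}
    (hw : ∀ u γ v, ¬ UsableZeros T w u γ v) (hp : numPairs w < T) :
    4 * (w.length + 3) ≤ (T + 3) ^ 2 := by
  obtain ⟨k, L, hL, rfl⟩ := exists_ofRuns w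
  have h1 := noUsableRuns_of_not_usableZeros hw L k [] hL (Or.inl rfl) (by simp)
  zify
  have hsq : (0 : ℤ) ≤ (T - 1) ^ 2 := sq_nonneg _
  rcases L with _ | ⟨⟨c, k'⟩, L⟩
  -- With at most one zero run the length is at most `2 * T - 1`, and `4 * (2 * T + 2) ≤ (T + 3) ^
  -- 2` is `hsq`. Only the string without zeros needs the bound on `numPairs`.
  · simp [ofRuns, numPairs_replicate_true] at *
    have : (k : ℤ) ≤ 2 * T - 1 := by omega
    nlinarith
  rcases eq_or_ne L [] with rfl | hne
  · obtain ⟨h1, -⟩ := h1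
    have hc := hL.1
    simp [runFaults, ofRuns_cons] at *
    have : (k + (c + (ofRuns k' []).length) : ℤ) ≤ 2 * T - 1 := by
      simp [ofRuns]; omega
    nlinarith
  · have h2 := length_le_of_noUsableRuns _ _ _ _ (by simp) h1 rfl
    have h3 := length_pred_le_runFaults hL
    have h4 : 2 ≤ ((c, k') :: L).length := by
      rcases L with _ | _
      · exact absurd rfl hne
      · simp
    generalize ((c, k') :: L) = L at *
    simp only [minFaults_nil, Nat.cast_zero, zero_add] at h2
    set μ : ℤ := (((k + 1) / 2 : ℕ) : ℤ) + runFaults L with hμ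
    have h5 : (L.length : ℤ) - 1 ≤ μ := by
      have : (0 : ℤ) ≤ ((k + 1) / 2 : ℕ) := Int.natCast_nonneg _
      zify at h3; linarith
    zify at h4
    -- With `m = L.length ≥ 2` the bound `m * (T - μ) + 2 * μ - 1` does not increase with `μ`, so `μ
    -- = m - 1` is the worst case, giving `m * (T + 3 - m) - 3`; the square is AM-GM.
    nlinarith [sq_nonneg (2 * (L.length : ℤ) - (T + 3)), mul_nonneg (sub_nonneg.2 h4) (sub_nonneg.2 h5)]

/-! ### Signs -/

theorem zmod_two_cases : ∀ s : ZMod 2, s = 0 ∨ s = 1 := by decide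

/-- The sign `(-1) ^ s`. -/
noncomputable def bitSign (s : ZMod 2) : ℂ := (-1) ^ s.val

@[simp] theorem bitSign_zero : bitSign 0 = 1 := by simp [bitSign]

@[simp] theorem bitSign_one : bitSign 1 = -1 := by
  simp [bitSign, show (1 : ZMod 2).val = 1 from rfl]

theorem bitSign_add (s s' : ZMod 2) : bitSign (s + s') = bitSign s * bitSign s' := by
  have h2 : (1 + 1 : ZMod 2) = 0 := rfl
  rcases zmod_two_cases s with rfl | rfl <;> rcases zmod_two_cases s' with rfl | rfl <;> simp [h2]

theorem bitSign_mul_self (s : ZMod 2) : bitSign s * bitSign s = 1 := by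
  rcases zmod_two_cases s with rfl | rfl <;> simp

theorem bitSign_ne_zero (s : ZMod 2) : bitSign s ≠ 0 := by
  rcases zmod_two_cases s with rfl | rfl <;> simp

theorem one_add_bitSign (s : ZMod 2) : 1 + bitSign s = if s = 0 then 2 else 0 := by
  rcases zmod_two_cases s with rfl | rfl <;> norm_num

theorem bitSign_sum {ι : Type*} (A : Finset ι) (f : ι → ZMod 2) :
    bitSign (∑ i ∈ A, f i) = ∏ i ∈ A, bitSign (f i) := by
  classical
  induction A using Finset.induction_on with
  | empty => simp
  | insert a A ha ih => rw [Finset.sum_insert ha, Finset.prod_insert ha, bitSign_add, ih]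

theorem neg_one_pow_val_mul_val (s s' : ZMod 2) :
    (-1 : ℂ) ^ (s.val * s'.val) = bitSign (s * s') := by
  rcases zmod_two_cases s with rfl | rfl <;> rcases zmod_two_cases s' with rfl | rfl <;>
    simp [show (1 : ZMod 2).val = 1 from rfl]

/-! ### The action of Pauli operators -/

/-- The bit flips of a Pauli operator. -/
def xPart {Q : Type} (p : PauliString Q) : Q → ZMod 2 := fun q => (p q).1

/-- The phase flips of a Pauli operator. -/
def zPart {Q : Type} (p : PauliString Q) : Q → ZMod 2 := fun q => (p q).2

@[simp] theorem xPart_add {Q : Type} (p p' : PauliString Q) :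
    xPart (p + p') = xPart p + xPart p' := rfl

@[simp] theorem zPart_add {Q : Type} (p p' : PauliString Q) :
    zPart (p + p') = zPart p + zPart p' := rfl

@[simp] theorem xPart_zero {Q : Type} : xPart (0 : PauliString Q) = 0 := rfl

@[simp] theorem zPart_zero {Q : Type} : zPart (0 : PauliString Q) = 0 := rfl

theorem pauliString_add_self {Q : Type} (p : PauliString Q) : p + p = 0 := by
  funext q
  exact Prod.ext (CharTwo.add_self_eq_zero _) (CharTwo.add_self_eq_zero _)

section Pauli

variable {Q : Type} [Fintype Q]

/-- The factor `i ^ (x z)` of a Pauli operator in front of its `X` and `Z` parts. -/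
noncomputable def pauliUnit (p : PauliString Q) : ℂ :=
  ∏ q, Complex.I ^ ((p q).1.val * (p q).2.val)

theorem pauliUnit_ne_zero (p : PauliString Q) : pauliUnit p ≠ 0 :=
  Finset.prod_ne_zero_iff.2 fun _ _ => pow_ne_zero _ Complex.I_ne_zero

@[simp] theorem pauliUnit_zero : pauliUnit (0 : PauliString Q) = 1 := by simp [pauliUnit]

theorem pauliOp_apply (p : PauliString Q) (b a : Q → ZMod 2) :
    pauliOp p b a = if a = b + xPart p then pauliUnit p * bitSign (zPart p ⬝ᵥ a) else 0 := by
  have hab : ∀ q, (b q = a q + (p q).1) ↔ a q = b q + (p q).1 := by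
    intro q
    generalize b q = x; generalize a q = y; generalize (p q).1 = z
    revert x y z; decide
  simp only [pauliOp, tensorOp, pauliMat, Matrix.of_apply, neg_one_pow_val_mul_val]
  rw [Finset.prod_ite_zero, Finset.prod_mul_distrib, ← bitSign_sum]
  congr 1
  simp only [Finset.mem_univ, true_implies, hab, funext_iff, Pi.add_apply, xPart]

/-- The scalar by which a product of two Pauli operators differs from the Hermitian one. -/
noncomputable def pauliMulScalar (p p' : PauliString Q) : ℂ :=
  pauliUnit p * pauliUnit p' / pauliUnit (p + p') * bitSign (zPart p ⬝ᵥ xPart p')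

theorem pauliMulScalar_ne_zero (p p' : PauliString Q) : pauliMulScalar p p' ≠ 0 :=
  mul_ne_zero (div_ne_zero (mul_ne_zero (pauliUnit_ne_zero _) (pauliUnit_ne_zero _))
    (pauliUnit_ne_zero _)) (bitSign_ne_zero _)

theorem pauliMulScalar_of_disjoint {p p' : PauliString Q} (h : ∀ q, p q = 0 ∨ p' q = 0) :
    pauliMulScalar p p' = 1 := by
  have h1 : pauliUnit (p + p') = pauliUnit p * pauliUnit p' := by
    simp only [pauliUnit, ← Finset.prod_mul_distrib]
    refine Finset.prod_congr rfl fun q _ => ?_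
    rcases h q with h | h <;> simp [h]
  have h2 : zPart p ⬝ᵥ xPart p' = 0 := by
    refine Finset.sum_eq_zero fun q _ => ?_
    rcases h q with h | h <;> simp [xPart, zPart, h]
  have h3 := pauliUnit_ne_zero (p + p')
  rw [pauliMulScalar, h2, ← h1, div_self h3]; simp

variable [DecidableEq Q]

theorem pauliOp_mulVec (p : PauliString Q) (ψ : QState Q) (b : Q → ZMod 2) :
    (pauliOp p *ᵥ ψ) b =
      pauliUnit p * bitSign (zPart p ⬝ᵥ (b + xPart p)) * ψ (b + xPart p) := by
  simp [Matrix.mulVec, dotProduct, pauliOp_apply, ite_mul]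

@[simp] theorem pauliOp_zero_mulVec (ψ : QState Q) :
    pauliOp (0 : PauliString Q) *ᵥ ψ = ψ := by
  funext b
  simp [pauliOp_mulVec]

theorem pauliOp_mulVec_pauliOp_mulVec (p p' : PauliString Q) (ψ : QState Q) :
    pauliOp p *ᵥ (pauliOp p' *ᵥ ψ) = pauliMulScalar p p' • (pauliOp (p + p') *ᵥ ψ) := by
  funext b
  have h := pauliUnit_ne_zero (p + p')
  simp only [Pi.smul_apply, smul_eq_mul, pauliOp_mulVec, pauliMulScalar, xPart_add, zPart_add,
    dotProduct_add, add_dotProduct, bitSign_add, ← add_assoc]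
  have h2 := bitSign_mul_self (zPart p ⬝ᵥ xPart p')
  field_simp
  linear_combination (-(bitSign (zPart p ⬝ᵥ b) * bitSign (zPart p ⬝ᵥ xPart p) *
    bitSign (zPart p' ⬝ᵥ b) * bitSign (zPart p' ⬝ᵥ xPart p) * bitSign (zPart p' ⬝ᵥ xPart p') *
    pauliUnit p * pauliUnit p' * ψ (b + xPart p + xPart p'))) * h2

theorem pauliOp_mulVec_comm (p p' : PauliString Q) (ψ : QState Q) :
    pauliOp p *ᵥ (pauliOp p' *ᵥ ψ) =
      bitSign (symplectic p p') • (pauliOp p' *ᵥ (pauliOp p *ᵥ ψ)) := by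
  rw [pauliOp_mulVec_pauliOp_mulVec, pauliOp_mulVec_pauliOp_mulVec, smul_smul, add_comm p' p]
  congr 1
  have : symplectic p p' = zPart p ⬝ᵥ xPart p' + zPart p' ⬝ᵥ xPart p := by
    simp only [symplectic, dotProduct, xPart, zPart, ← Finset.sum_add_distrib]
    exact Finset.sum_congr rfl fun q _ => by ring
  rw [this, bitSign_add, pauliMulScalar, pauliMulScalar, add_comm p' p]
  have h2 := bitSign_mul_self (zPart p' ⬝ᵥ xPart p)
  linear_combination (-(pauliUnit p * pauliUnit p' / pauliUnit (p + p') *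
    bitSign (zPart p ⬝ᵥ xPart p'))) * h2

end Pauli

/-! ### Data states with the ancilla qubits in a computational basis state -/

section prodBasis

variable {Q A : Type} [Fintype Q] [Fintype A] [DecidableEq Q] [DecidableEq A]

/-- The state `φ ⊗ |x⟩`. -/
def prodBasis {Q A : Type} [Fintype A] (φ : QState Q) (x : A → ZMod 2) :
    QState (Q ⊕ A) := fun b =>
  if (fun a => b (Sum.inr a)) = x then φ (fun q => b (Sum.inl q)) else 0

theorem prodBasis_smul {Q A : Type} [Fintype A] (c : ℂ) (φ : QState Q) (x : A → ZMod 2) :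
    prodBasis (c • φ) x = c • prodBasis φ x := by
  funext b; simp [prodBasis]

theorem pauliOp_mulVec_prodBasis (d : PauliString Q) (e : PauliString A) (φ : QState Q)
    (x : A → ZMod 2) :
    pauliOp (Sum.elim d e) *ᵥ prodBasis φ x =
      (pauliUnit e * bitSign (zPart e ⬝ᵥ x)) • prodBasis (pauliOp d *ᵥ φ) (x + xPart e) := by
  funext b
  obtain ⟨b₁, b₂, rfl⟩ : ∃ b₁ b₂, b = Sum.elim b₁ b₂ := ⟨_, _, (Sum.elim_comp_inl_inr b).symm⟩
  have hu : pauliUnit (Sum.elim d e : PauliString (Q ⊕ A)) = pauliUnit d * pauliUnit e := by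
    simp [pauliUnit, Fintype.prod_sum_type]
  have hd : zPart (Sum.elim d e : PauliString (Q ⊕ A)) ⬝ᵥ
      (Sum.elim b₁ b₂ + xPart (Sum.elim d e : PauliString (Q ⊕ A))) =
      zPart d ⬝ᵥ (b₁ + xPart d) + zPart e ⬝ᵥ (b₂ + xPart e) := by
    simp [dotProduct, Fintype.sum_sum_type, zPart, xPart]
  have hx : b₂ + xPart e = x ↔ b₂ = x + xPart e := by
    simp only [funext_iff, Pi.add_apply]
    refine forall_congr' fun a => ?_
    generalize b₂ a = u; generalize xPart e a = v; generalize x a = w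
    revert u v w; decide
  have h1 : (fun a => (Sum.elim b₁ b₂ + xPart (Sum.elim d e : PauliString (Q ⊕ A))) (Sum.inr a)) =
    b₂ + xPart e := rfl
  have h2 : (fun a => (Sum.elim b₁ b₂ + xPart (Sum.elim d e : PauliString (Q ⊕ A))) (Sum.inl a)) =
    b₁ + xPart d := rfl
  rw [pauliOp_mulVec, hu, hd, bitSign_add, Pi.smul_apply, smul_eq_mul]
  simp only [prodBasis, h1, h2, hx, Sum.elim_inr, Sum.elim_inl, pauliOp_mulVec]
  by_cases h : b₂ = x + xPart e
  · have h3 : b₂ + xPart e = x := hx.2 h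
    rw [if_pos h, if_pos h, h3]; ring
  · rw [if_neg h, if_neg h]; simp

theorem controlledPauli_mulVec_prodBasis (a : A) (q : Q) (P : Pauli) (φ : QState Q)
    (x : A → ZMod 2) :
    controlledPauli (Sum.inr a) (Sum.inl q) P *ᵥ prodBasis φ x =
      prodBasis (pauliOp (Pi.single q (x a • P)) *ᵥ φ) x := by
  have h1 : ∀ b, (controlledPauli (Sum.inr a) (Sum.inl q) P *ᵥ prodBasis φ x) b =
      if b (Sum.inr a) = 0 then prodBasis φ x b else
        (pauliOp (Pi.single (Sum.inl q) P : PauliString (Q ⊕ A)) *ᵥ prodBasis φ x) b := by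
    intro b
    simp only [controlledPauli, Matrix.mulVec, dotProduct, Matrix.of_apply]
    split_ifs with h
    · simp [Matrix.one_apply]
    · rfl
  have h2 : (Pi.single (Sum.inl q) P : PauliString (Q ⊕ A)) = Sum.elim (Pi.single q P) 0 := by
    funext i
    rcases i with i | i <;> simp [Pi.single_apply]
  funext b
  rw [h1, h2, pauliOp_mulVec_prodBasis]
  by_cases h : (fun a => b (Sum.inr a)) = x
  · have h3 : b (Sum.inr a) = x a := congrFun h a
    rw [h3]
    rcases zmod_two_cases (x a) with h4 | h4
    · simp [h4]
    · simp [h4]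
  · simp [prodBasis, h]

theorem tensorOp_ancilla_mulVec_prodBasis (U : A → Matrix (ZMod 2) (ZMod 2) ℂ) (φ : QState Q)
    (x : A → ZMod 2) (b : Q → ZMod 2) (m : A → ZMod 2) :
    (tensorOp (Sum.elim (fun _ => 1) U) *ᵥ prodBasis φ x) (Sum.elim b m) =
      (∏ a, U a (m a) (x a)) * φ b := by
  rw [Matrix.mulVec, dotProduct, Finset.sum_eq_single (Sum.elim b x)]
  · simp [tensorOp, prodBasis, Fintype.prod_sum_type, Matrix.one_apply]
  · intro y _ hy
    obtain ⟨y₁, y₂, rfl⟩ : ∃ y₁ y₂, y = Sum.elim y₁ y₂ := ⟨_, _, (Sum.elim_comp_inl_inr y).symm⟩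
    by_cases h2 : y₂ = x
    · subst h2
      have h1 : ∃ q, b q ≠ y₁ q := by
        by_contra! h
        exact hy (by rw [funext h])
      obtain ⟨q, hq⟩ := h1
      have h0 : ∏ q, (1 : Matrix (ZMod 2) (ZMod 2) ℂ) (b q) (y₁ q) = 0 :=
        Finset.prod_eq_zero (Finset.mem_univ q) (Matrix.one_apply_ne hq)
      have h1 : tensorOp (Sum.elim (fun _ => 1) U) (Sum.elim b m) (Sum.elim y₁ y₂) =
          (∏ q, (1 : Matrix (ZMod 2) (ZMod 2) ℂ) (b q) (y₁ q)) * ∏ a, U a (m a) (y₂ a) := by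
        rw [tensorOp, Matrix.of_apply, Fintype.prod_sum_type]
        rfl
      rw [h1, h0]; simp
    · simp [prodBasis, h2]
  · simp

end prodBasis

theorem hadamardMat_apply (u v : ZMod 2) :
    hadamardMat u v = bitSign (u * v) / ((Real.sqrt 2 : ℝ) : ℂ) := by
  rw [hadamardMat, Matrix.of_apply, neg_one_pow_val_mul_val]

theorem pauliOp_ancilla_mulVec {Q A : Type} [Fintype Q] [Fintype A] [DecidableEq Q]
    [DecidableEq A] (e : PauliString A) (Ψ : QState (Q ⊕ A)) (b : Q → ZMod 2) (m : A → ZMod 2) :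
    (pauliOp (Sum.elim 0 e) *ᵥ Ψ) (Sum.elim b m) =
      pauliUnit e * bitSign (zPart e ⬝ᵥ (m + xPart e)) * Ψ (Sum.elim b (m + xPart e)) := by
  have hu : pauliUnit (Sum.elim 0 e : PauliString (Q ⊕ A)) = pauliUnit e := by
    simp [pauliUnit, Fintype.prod_sum_type]
  have hx : Sum.elim b m + xPart (Sum.elim 0 e : PauliString (Q ⊕ A)) =
      Sum.elim b (m + xPart e) := by
    funext i
    rcases i with i | i <;> simp [xPart]
  have hz : zPart (Sum.elim 0 e : PauliString (Q ⊕ A)) ⬝ᵥ Sum.elim b (m + xPart e) =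
      zPart e ⬝ᵥ (m + xPart e) := by
    simp [dotProduct, Fintype.sum_sum_type, zPart]
  rw [pauliOp_mulVec, hu, hx, hz]

/-! ### The Shor circuit -/

theorem foldl_mulVec_smul {ι α : Type*} [Fintype ι] (A B : α → Matrix ι ι ℂ) (L : List α) (c : ℂ) :
    ∀ u : ι → ℂ, L.foldl (fun ψ a => A a *ᵥ (B a *ᵥ ψ)) (c • u) =
      c • L.foldl (fun ψ a => A a *ᵥ (B a *ᵥ ψ)) u := by
  induction L with
  | nil => simp
  | cons a L ih => intro u; simp only [List.foldl_cons, Matrix.mulVec_smul, ih]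

theorem foldl_mulVec_add {ι α : Type*} [Fintype ι] (A B : α → Matrix ι ι ℂ) (L : List α) :
    ∀ u v : ι → ℂ, L.foldl (fun ψ a => A a *ᵥ (B a *ᵥ ψ)) (u + v) =
      L.foldl (fun ψ a => A a *ᵥ (B a *ᵥ ψ)) u + L.foldl (fun ψ a => A a *ᵥ (B a *ᵥ ψ)) v := by
  induction L with
  | nil => simp
  | cons a L ih => intro u v; simp only [List.foldl_cons, Matrix.mulVec_add, ih]

theorem list_sum_single_apply_of_notMem {Q A : Type} [DecidableEq Q] (pos : A → Q)
    (f : A → Pauli) (L : List A) (q : Q) (hq : ∀ a ∈ L, pos a ≠ q) :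
    (L.map fun a => (Pi.single (pos a) (f a) : PauliString Q)).sum q = 0 := by
  induction L with
  | nil => simp
  | cons a L ih =>
    rw [List.map_cons, List.sum_cons, Pi.add_apply, ih fun a ha => hq a (List.mem_cons_of_mem _ ha),
      Pi.single_eq_of_ne (hq a List.mem_cons_self).symm, add_zero]

/-- A computational basis state of the ancilla stays one, so each branch of the cat state only
collects a Pauli error on the data. The clause for `gate = 0` keeps exact scalars, which are needed
when the two branches interfere. -/
theorem foldl_gates_prodBasis {g : PauliString (Fin n)} (gate : Supp g → Pauli × Pauli)
    (L : List (Supp g)) (hL : L.Nodup) : ∀ (φ : QState (Fin n)) (x : Supp g → ZMod 2),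
    ∃ (c : ℂ) (x' : Supp g → ZMod 2), (gate = 0 → c = 1 ∧ x' = x) ∧
      L.foldl (fun ψ a =>
        pauliOp (Sum.elim (Pi.single a.1 (gate a).2) (Pi.single a (gate a).1)) *ᵥ
          (controlledPauli (Sum.inr a) (Sum.inl a.1) (g a.1) *ᵥ ψ)) (prodBasis φ x) =
      c • prodBasis (pauliOp ((L.map fun a =>
        (Pi.single a.1 (x a • g a.1 + (gate a).2) : PauliString (Fin n))).sum) *ᵥ φ) x' := by
  induction L with
  | nil => intro φ x; exact ⟨1, x, fun _ => ⟨rfl, rfl⟩, by simp⟩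
  | cons a L ih =>
    intro φ x
    obtain ⟨ha, hL⟩ := List.nodup_cons.1 hL
    obtain ⟨c, x', hc, h⟩ := ih hL
      (pauliOp (Pi.single a.1 (x a • g a.1 + (gate a).2) : PauliString (Fin n)) *ᵥ φ)
      (x + xPart (Pi.single a (gate a).1 : PauliString (Supp g)))
    -- The ancilla error after the gate at `a` changes only ancilla `a`, which controls no later
    -- gate.
    have hmap : (L.map fun a' => (Pi.single a'.1 ((x + xPart (Pi.single a (gate a).1 :
        PauliString (Supp g))) a' • g a'.1 + (gate a').2) : PauliString (Fin n))) =
        L.map fun a => (Pi.single a.1 (x a • g a.1 + (gate a).2) : PauliString (Fin n)) := by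
      refine List.map_congr_left fun a' ha' => ?_
      have : a' ≠ a := fun h => ha (h ▸ ha')
      simp [xPart, this]
    rw [hmap] at h
    have hdisj := pauliMulScalar_of_disjoint
      (p := (L.map fun a => (Pi.single a.1 (x a • g a.1 + (gate a).2) : PauliString (Fin n))).sum)
      (p' := (Pi.single a.1 (x a • g a.1 + (gate a).2) : PauliString (Fin n))) (by
        intro q
        by_cases hq : q = a.1
        · left
          apply list_sum_single_apply_of_notMem (fun a : Supp g => a.1)
          intro a' ha' h
          exact ha (Subtype.ext (h.trans hq) ▸ ha')
        · right
          exact Pi.single_eq_of_ne hq _)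
    rw [pauliOp_mulVec_pauliOp_mulVec, hdisj, one_smul] at h
    simp only [List.foldl_cons, controlledPauli_mulVec_prodBasis, pauliOp_mulVec_prodBasis,
      pauliOp_mulVec_pauliOp_mulVec, prodBasis_smul, foldl_mulVec_smul, smul_smul,
      ← Pi.single_add, add_comm (gate a).2]
    rw [h, smul_smul]
    refine ⟨_, x', ?_, by rw [List.map_cons, List.sum_cons, add_comm]⟩
    intro hg
    have hm : pauliMulScalar (Pi.single a.1 (gate a).2 : PauliString (Fin n))
        (Pi.single a.1 (x a • g a.1)) = 1 :=
      pauliMulScalar_of_disjoint fun q => Or.inl (by simp [hg])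
    obtain ⟨rfl, rfl⟩ := hc hg
    rw [hm]
    simp [hg]

/-- The error on the data qubits after the Shor circuit for `g` if the ancilla qubits are in the
computational basis state `x` before the controlled Pauli gates. -/
def dataError {g : PauliString (Fin n)} (gate : Supp g → Pauli × Pauli) (x : Supp g → ZMod 2) :
    PauliString (Fin n) := fun q =>
  if h : g q ≠ 0 then x ⟨q, h⟩ • g q + (gate ⟨q, h⟩).2 else 0

theorem sum_single_eq_dataError {g : PauliString (Fin n)} (gate : Supp g → Pauli × Pauli)
    (x : Supp g → ZMod 2) :
    ((((Finset.univ : Finset (Supp g)).sort (· ≤ ·)).map fun a =>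
      (Pi.single a.1 (x a • g a.1 + (gate a).2) : PauliString (Fin n))).sum) =
      dataError gate x := by
  rw [← List.sum_toFinset _ (Finset.sort_nodup _ _), Finset.sort_toFinset]
  funext q
  rw [Finset.sum_apply, dataError]
  split_ifs with h
  · rw [Finset.sum_eq_single ⟨q, h⟩]
    · simp
    · intro a _ ha
      exact Pi.single_eq_of_ne (fun h' => ha (Subtype.ext h'.symm)) _
    · simp
  · refine Finset.sum_eq_zero fun a _ => Pi.single_eq_of_ne ?_ _
    rintro rfl
    exact h a.2

/-- Complementing `x` passes to the other branch of the cat state. -/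
theorem dataError_one_add {g : PauliString (Fin n)} (gate : Supp g → Pauli × Pauli)
    (x : Supp g → ZMod 2) : dataError gate (1 + x) = dataError gate x + g := by
  funext q
  simp only [dataError, Pi.add_apply]
  split_ifs with h
  · simp only [Pi.one_apply, add_smul, one_smul]; abel
  · simp only [ne_eq, not_not] at h; simp [h]

/-- A data qubit is hit only if its ancilla qubit had a preparation error or its gate was faulty.
Hadamard and readout faults never reach the data. -/
theorem hammingNorm_dataError_le {g : PauliString (Fin n)} (F : GenFault g) :
    hammingNorm (dataError F.gate (xPart F.prep)) ≤ F.count := by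
  classical
  have h1 : hammingNorm (dataError F.gate (xPart F.prep)) ≤
      hammingNorm F.prep + hammingNorm F.gate := by
    unfold hammingNorm
    refine le_trans (Finset.card_le_card (t := ((Finset.univ.filter fun a => F.prep a ≠ 0) ∪
      (Finset.univ.filter fun a => F.gate a ≠ 0)).image fun a : Supp g => a.1) ?_)
      (Finset.card_image_le.trans (Finset.card_union_le _ _))
    intro q hq
    replace hq := (Finset.mem_filter.1 hq).2
    simp only [dataError] at hq
    split_ifs at hq with h
    · refine Finset.mem_image.2 ⟨⟨q, h⟩, ?_, rfl⟩
      by_contra hcon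
      simp only [Finset.mem_union, Finset.mem_filter, Finset.mem_univ, true_and, not_or,
        not_not] at hcon
      exact hq (by simp [xPart, hcon.1, hcon.2])
    · exact absurd rfl hq
  unfold GenFault.count
  omega

theorem catState_product {A : Type} [Fintype A] [DecidableEq A] (ψ : QState (Fin n)) :
    (fun b : Fin n ⊕ A → ZMod 2 =>
      ψ (fun q => b (Sum.inl q)) * catState A (fun a => b (Sum.inr a))) =
      (((Real.sqrt 2 : ℝ) : ℂ))⁻¹ • (prodBasis ψ 0 + prodBasis ψ 1) := by
  funext b
  simp only [catState, prodBasis, Pi.smul_apply, Pi.add_apply, smul_eq_mul, funext_iff,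
    Pi.zero_apply, Pi.one_apply]
  split_ifs <;> ring

theorem prod_hadamardMat_one {A : Type} [Fintype A] (m : A → ZMod 2) :
    ∏ a, hadamardMat (m a) 1 = bitSign (∑ a, m a) * ∏ a, hadamardMat (m a) 0 := by
  rw [bitSign_sum, ← Finset.prod_mul_distrib]
  refine Finset.prod_congr rfl fun a _ => ?_
  simp [hadamardMat_apply]
  ring

theorem GenFault.eq_zero_of_count {g : PauliString (Fin n)} {F : GenFault g} (h : F.count = 0) :
    F.prep = 0 ∧ F.gate = 0 ∧ F.had = 0 ∧ F.flip = 0 := by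
  simpa [GenFault.count, and_assoc] using h

/-- On an eigenstate of `g`, the Shor circuit for `g` acts as a Pauli error of weight at most the
number of faults. -/
theorem shorCircuit_of_eigenstate {g : PauliString (Fin n)} (F : GenFault g) {ψ : QState (Fin n)}
    {ε : ℂ} (hψ : pauliOp g *ᵥ ψ = ε • ψ) (m : Supp g → ZMod 2) :
    ∃ (a : ℂ) (D : PauliString (Fin n)),
      (fun b => shorCircuit g F ψ (Sum.elim b m)) = a • (pauliOp D *ᵥ ψ) ∧
      hammingNorm D ≤ F.count ∧
      (F.count = 0 → ∃ κ, a = κ * (1 + bitSign (∑ a, m a) * ε)) := by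
  set x := xPart F.prep with hx
  set D := dataError F.gate x with hD
  obtain ⟨c₀, x₀, hc₀, h₀⟩ := foldl_gates_prodBasis F.gate _
    (Finset.sort_nodup (Finset.univ : Finset (Supp g)) (· ≤ ·)) ψ x
  obtain ⟨c₁, x₁, hc₁, h₁⟩ := foldl_gates_prodBasis F.gate _
    (Finset.sort_nodup (Finset.univ : Finset (Supp g)) (· ≤ ·)) ψ (1 + x)
  rw [sum_single_eq_dataError, ← hD] at h₀
  -- The eigenvector property makes both branches proportional to the same data state.
  have hg : pauliOp (D + g) *ᵥ ψ = ((pauliMulScalar D g)⁻¹ * ε) • (pauliOp D *ᵥ ψ) := by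
    have h := pauliOp_mulVec_pauliOp_mulVec D g ψ
    rw [hψ, Matrix.mulVec_smul] at h
    rw [mul_smul, h, inv_smul_smul₀ (pauliMulScalar_ne_zero D g)]
  rw [sum_single_eq_dataError, dataError_one_add, ← hD, hg, prodBasis_smul, smul_smul] at h₁
  refine ⟨pauliUnit F.had * bitSign (zPart F.had ⬝ᵥ (m + xPart F.had)) *
    (((Real.sqrt 2 : ℝ) : ℂ))⁻¹ *
    (pauliUnit F.prep * bitSign (zPart F.prep ⬝ᵥ 0) * c₀ *
        (∏ a, hadamardMat ((m + xPart F.had) a) (x₀ a)) +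
      pauliUnit F.prep * bitSign (zPart F.prep ⬝ᵥ 1) * (c₁ * ((pauliMulScalar D g)⁻¹ * ε)) *
        (∏ a, hadamardMat ((m + xPart F.had) a) (x₁ a))), D, ?_, hammingNorm_dataError_le F, ?_⟩
  · funext b
    simp only [shorCircuit, catState_product, Matrix.mulVec_smul, Matrix.mulVec_add,
      pauliOp_mulVec_prodBasis, pauliOp_zero_mulVec, foldl_mulVec_smul, foldl_mulVec_add,
      zero_add, ← hx, h₀, h₁, Pi.smul_apply, Pi.add_apply, smul_eq_mul, pauliOp_ancilla_mulVec,
      tensorOp_ancilla_mulVec_prodBasis]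
    ring
  -- Without faults the branches differ only by the eigenvalue `ε` and by the sign that the Hadamard
  -- gates produce from the outcome parity.
  · intro hF
    obtain ⟨hp, hga, hh, -⟩ := GenFault.eq_zero_of_count hF
    obtain ⟨rfl, rfl⟩ := hc₀ hga
    obtain ⟨rfl, rfl⟩ := hc₁ hga
    have hx0 : x = 0 := by rw [hx, hp]; rfl
    have hD0 : D = 0 := by
      rw [hD, hx0, hga]; funext q; simp [dataError]
    have hm : pauliMulScalar D g = 1 := pauliMulScalar_of_disjoint fun q => Or.inl (by simp [hD0])
    refine ⟨(((Real.sqrt 2 : ℝ) : ℂ))⁻¹ * ∏ a, hadamardMat (m a) 0, ?_⟩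
    rw [hm, hp, hh, hx0]
    have := prod_hadamardMat_one m
    simp only [pauliUnit_zero, zPart_zero, xPart_zero, zero_dotProduct, bitSign_zero, add_zero,
      Pi.zero_apply, Pi.one_apply, this]
    ring

/-! ### Weights and syndromes -/

theorem hammingNorm_add_le {Q : Type} [Fintype Q] (p p' : PauliString Q) :
    hammingNorm (p + p') ≤ hammingNorm p + hammingNorm p' := by
  classical
  unfold hammingNorm
  refine (Finset.card_le_card ?_).trans (Finset.card_union_le _ _)
  intro q
  simp only [Finset.mem_filter, Finset.mem_univ, true_and, Finset.mem_union, Pi.add_apply]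
  contrapose!
  rintro ⟨h, h'⟩
  rw [h, h', add_zero]

theorem symplectic_add {Q : Type} [Fintype Q] (p p₁ p₂ : PauliString Q) :
    symplectic p (p₁ + p₂) = symplectic p p₁ + symplectic p p₂ := by
  simp only [symplectic, ← Finset.sum_add_distrib]
  refine Finset.sum_congr rfl fun q _ => ?_
  simp only [Pi.add_apply, Prod.fst_add, Prod.snd_add]
  ring

theorem syndromeOf_add (C : StabilizerCode n l) (p p' : PauliString (Fin n)) :
    syndromeOf C (p + p') = syndromeOf C p + syndromeOf C p' :=
  funext fun _ => symplectic_add _ _ _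

theorem syndromeOf_zero (C : StabilizerCode n l) : syndromeOf C 0 = 0 := by
  funext j; simp [syndromeOf, symplectic]

theorem eq_of_hammingNorm_add_eq_zero {Q : Type} [Fintype Q] {p p' : PauliString Q}
    (h : hammingNorm (p + p') = 0) : p = p' := by
  rw [hammingNorm_eq_zero] at h
  calc p = p + (p' + p') := by rw [pauliString_add_self, add_zero]
    _ = p' := by rw [← add_assoc, h, zero_add]

theorem mem_span_of_syndromeOf_eq {C : StabilizerCode n l} {R E : PauliString (Fin n)}
    (h : syndromeOf C R = syndromeOf C E) (hw : hammingNorm R + hammingNorm E < distance C) :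
    R + E ∈ Submodule.span (ZMod 2) (Set.range C.gen) := by
  by_contra hcon
  have h1 : syndromeOf C (R + E) = 0 := by
    rw [syndromeOf_add, h]
    exact funext fun _ => CharTwo.add_self_eq_zero _
  have h2 : distance C ≤ hammingNorm (R + E) := Nat.sInf_le ⟨R + E, ⟨h1, hcon⟩, rfl⟩
  have h3 := hammingNorm_add_le R E
  omega

/-- By minimality `R` weighs no more than `E`, so their product is too light to be a nontrivial
logical operator. -/
theorem recovery_add_mem_span {C : StabilizerCode n l} {R E : PauliString (Fin n)}
    (hR : IsRecovery C (syndromeOf C E) R) (hw : 2 * hammingNorm E < distance C) :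
    R + E ∈ Submodule.span (ZMod 2) (Set.range C.gen) :=
  mem_span_of_syndromeOf_eq hR.1 (by have := hR.2 E rfl; omega)

/-! ### Codewords with errors -/

theorem IsCodeword.pauliOp_gen_mulVec {C : StabilizerCode n l} {c : QState (Fin n)}
    (hc : IsCodeword C c) (j : Fin l) : pauliOp (C.gen j) *ᵥ c = bitSign (C.sign j) • c := by
  have h : bitSign (C.sign j) • (pauliOp (C.gen j) *ᵥ c) = c := by
    rw [← Matrix.smul_mulVec]; exact hc.2 j
  conv_rhs => rw [← h]
  rw [smul_smul, bitSign_mul_self, one_smul]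

theorem IsCodeword.pauliOp_gen_mulVec_error {C : StabilizerCode n l} {c : QState (Fin n)}
    (hc : IsCodeword C c) (j : Fin l) (a : ℂ) (E : PauliString (Fin n)) :
    pauliOp (C.gen j) *ᵥ (a • (pauliOp E *ᵥ c)) =
      bitSign (syndromeOf C E j + C.sign j) • (a • (pauliOp E *ᵥ c)) := by
  rw [Matrix.mulVec_smul, pauliOp_mulVec_comm, hc.pauliOp_gen_mulVec, Matrix.mulVec_smul,
    bitSign_add, smul_smul, smul_smul, smul_smul]
  congr 1
  rw [syndromeOf]; ring

theorem IsCodeword.smul {C : StabilizerCode n l} {c : QState (Fin n)} (hc : IsCodeword C c)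
    {a : ℂ} (ha : a ≠ 0) : IsCodeword C (a • c) :=
  ⟨smul_ne_zero ha hc.1, fun j => by rw [Matrix.mulVec_smul, hc.2 j]⟩

theorem IsCodeword.pauliOp_mulVec_of_mem_span {C : StabilizerCode n l} {c : QState (Fin n)}
    (hc : IsCodeword C c) {p : PauliString (Fin n)}
    (hp : p ∈ Submodule.span (ZMod 2) (Set.range C.gen)) :
    ∃ a : ℂ, a ≠ 0 ∧ pauliOp p *ᵥ c = a • c := by
  induction hp using Submodule.span_induction with
  | mem p hp =>
    obtain ⟨j, rfl⟩ := hp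
    exact ⟨_, bitSign_ne_zero _, hc.pauliOp_gen_mulVec j⟩
  | zero => exact ⟨1, one_ne_zero, by simp⟩
  | add p p' _ _ ih ih' =>
    obtain ⟨a, ha, h⟩ := ih
    obtain ⟨a', ha', h'⟩ := ih'
    have h1 := pauliOp_mulVec_pauliOp_mulVec p p' c
    rw [h', Matrix.mulVec_smul, h, smul_smul] at h1
    refine ⟨(pauliMulScalar p p')⁻¹ * (a' * a), mul_ne_zero
      (inv_ne_zero (pauliMulScalar_ne_zero _ _)) (mul_ne_zero ha' ha), ?_⟩
    rw [mul_smul, h1, inv_smul_smul₀ (pauliMulScalar_ne_zero _ _)]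
  | smul s p _ ih =>
    rcases zmod_two_cases s with rfl | rfl
    · exact ⟨1, one_ne_zero, by simp⟩
    · simpa using ih

/-- `ψ` is, up to a scalar, the codeword `c` with the Pauli error `E`. -/
def IsErrorState (c : QState (Fin n)) (E : PauliString (Fin n)) (ψ : QState (Fin n)) : Prop :=
  ∃ a : ℂ, a ≠ 0 ∧ ψ = a • (pauliOp E *ᵥ c)

theorem IsErrorState.pauliOp_mulVec {c ψ : QState (Fin n)} {E : PauliString (Fin n)}
    (h : IsErrorState c E ψ) (p : PauliString (Fin n)) :
    IsErrorState c (p + E) (pauliOp p *ᵥ ψ) := by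
  obtain ⟨a, ha, rfl⟩ := h
  refine ⟨a * pauliMulScalar p E, mul_ne_zero ha (pauliMulScalar_ne_zero _ _), ?_⟩
  rw [Matrix.mulVec_smul, pauliOp_mulVec_pauliOp_mulVec, smul_smul]

theorem IsErrorState.of_add_mem_span {C : StabilizerCode n l} {c ψ : QState (Fin n)}
    (hc : IsCodeword C c) {p E : PauliString (Fin n)} (h : IsErrorState c (E + p) ψ)
    (hp : p ∈ Submodule.span (ZMod 2) (Set.range C.gen)) : IsErrorState c E ψ := by
  obtain ⟨a, ha, rfl⟩ := h
  obtain ⟨b, hb, h⟩ := hc.pauliOp_mulVec_of_mem_span hp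
  have h1 := pauliOp_mulVec_pauliOp_mulVec E p c
  rw [h, Matrix.mulVec_smul] at h1
  refine ⟨a * ((pauliMulScalar E p)⁻¹ * b), mul_ne_zero ha (mul_ne_zero
    (inv_ne_zero (pauliMulScalar_ne_zero _ _)) hb), ?_⟩
  rw [mul_smul, mul_smul, h1, inv_smul_smul₀ (pauliMulScalar_ne_zero _ _)]

/-! ### Ideal decoding -/

/-- The state is a joint eigenvector, so each factor of the projector acts as `1` or `0`. -/
theorem syndromeProjector_mulVec {C : StabilizerCode n l} {c ψ : QState (Fin n)}
    (hc : IsCodeword C c) {E : PauliString (Fin n)} (hψ : IsErrorState c E ψ) (σ : Syndrome l) :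
    syndromeProjector C σ *ᵥ ψ = if σ = syndromeOf C E then ψ else 0 := by
  obtain ⟨a, -, rfl⟩ := hψ
  have hj : ∀ j, ((1 / 2 : ℂ) • (1 + (-1 : ℂ) ^ (C.sign j + σ j).val • pauliOp (C.gen j))) *ᵥ
      (a • (pauliOp E *ᵥ c)) =
      (if σ j = syndromeOf C E j then (1 : ℂ) else 0) • (a • (pauliOp E *ᵥ c)) := by
    intro j
    have h1 : (-1 : ℂ) ^ (C.sign j + σ j).val = bitSign (C.sign j + σ j) := rfl
    have h2 : C.sign j + σ j + (syndromeOf C E j + C.sign j) = 0 ↔ σ j = syndromeOf C E j := by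
      generalize C.sign j = x; generalize σ j = y; generalize syndromeOf C E j = z
      revert x y z; decide
    rw [h1, Matrix.smul_mulVec, Matrix.add_mulVec, Matrix.smul_mulVec, Matrix.one_mulVec,
      hc.pauliOp_gen_mulVec_error, smul_smul (bitSign _), ← bitSign_add]
    nth_rewrite 1 [← one_smul ℂ (a • (pauliOp E *ᵥ c))]
    rw [← add_smul, one_add_bitSign, smul_smul]
    congr 1
    simp only [h2]
    split_ifs <;> norm_num
  have hind : ∀ L : List (Fin l),
      (L.map fun j => (1 / 2 : ℂ) • (1 + (-1 : ℂ) ^ (C.sign j + σ j).val •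
        pauliOp (C.gen j))).prod *ᵥ (a • (pauliOp E *ᵥ c)) =
      if ∀ j ∈ L, σ j = syndromeOf C E j then a • (pauliOp E *ᵥ c) else 0 := by
    intro L
    induction L with
    | nil => simp
    | cons j L ih =>
      rw [List.map_cons, List.prod_cons, ← Matrix.mulVec_mulVec, ih]
      simp only [List.forall_mem_cons]
      by_cases h1 : ∀ j ∈ L, σ j = syndromeOf C E j
      · rw [if_pos h1, hj]
        by_cases h2 : σ j = syndromeOf C E j
        · rw [if_pos h2, one_smul, if_pos ⟨h2, h1⟩]
        · rw [if_neg h2, zero_smul, if_neg fun h => h2 h.1]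
      · rw [if_neg h1, Matrix.mulVec_zero, if_neg fun h => h1 h.2]
  rw [syndromeProjector, List.ofFn_eq_map, hind]
  simp only [List.mem_finRange, true_implies, funext_iff]

theorem IdeallyDecodesTo.isErrorState {C : StabilizerCode n l} {c ψ φ : QState (Fin n)}
    (hc : IsCodeword C c) {E : PauliString (Fin n)} (hψ : IsErrorState c E ψ)
    (hw : 2 * hammingNorm E < distance C) (h : IdeallyDecodesTo C ψ φ) : IsErrorState c 0 φ := by
  obtain ⟨σ, R, hR, rfl, hne⟩ := h
  rw [syndromeProjector_mulVec hc hψ] at hne ⊢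
  split_ifs at hne ⊢ with hσ
  · subst hσ
    refine IsErrorState.of_add_mem_span hc (p := R + E) ?_ (recovery_add_mem_span hR hw)
    rw [zero_add]
    exact hψ.pauliOp_mulVec R
  · simp at hne

/-! ### Syndrome measurement on a codeword with an error -/

/-- An outcome that occurs has nonzero amplitude; in the faultless case this forces the factor `1 ±
1` to be nonzero, which fixes the parity. -/
theorem GenMeasurement.exists_error {C : StabilizerCode n l} {c ψ ψ' : QState (Fin n)}
    (hc : IsCodeword C c) {E : PauliString (Fin n)} (hψ : IsErrorState c E ψ) {j : Fin l}
    {F : GenFault (C.gen j)} {s : ZMod 2} (h : GenMeasurement C j F ψ s ψ') :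
    ∃ D, IsErrorState c (D + E) ψ' ∧ hammingNorm D ≤ F.count ∧
      (F.count = 0 → s = syndromeOf C E j) := by
  obtain ⟨m, hm, hne, rfl⟩ := h
  have hψ' := hψ
  obtain ⟨a, ha, rfl⟩ := hψ
  obtain ⟨b, D, hb, hD, hF⟩ :=
    shorCircuit_of_eigenstate F (hc.pauliOp_gen_mulVec_error j a E) m
  rw [← hm] at hb
  have hb0 : b ≠ 0 := by
    rintro rfl
    exact hne (by rw [hb, zero_smul])
  refine ⟨D, ?_, hD, ?_⟩
  · obtain ⟨a', ha', h'⟩ := hψ'.pauliOp_mulVec D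
    exact ⟨b * a', mul_ne_zero hb0 ha', by rw [hb, h', smul_smul]⟩
  · intro h0
    obtain ⟨κ, hκ⟩ := hF h0
    clear hF
    have hflip := (GenFault.eq_zero_of_count h0).2.2.2
    rw [← bitSign_add, one_add_bitSign] at hκ
    split_ifs at hκ with hs
    · simp only [hflip, Pi.zero_apply, add_zero]
      generalize ∑ a, m a = x at *; generalize C.sign j = y at *
      generalize syndromeOf C E j = z at *
      revert x y z; decide
    · exact absurd (by simp [hκ]) hb0

theorem FullMeasurement.exists_error {C : StabilizerCode n l} {c ψ ψ' : QState (Fin n)}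
    (hc : IsCodeword C c) {E : PauliString (Fin n)} (hψ : IsErrorState c E ψ)
    {F : RoundFault C} {s : Syndrome l} (h : FullMeasurement C F ψ s ψ') :
    ∃ E', IsErrorState c E' ψ' ∧ hammingNorm (E' + E) ≤ ∑ j, (F j).count ∧
      (∑ j, (F j).count = 0 → s = syndromeOf C E) := by
  obtain ⟨φ, rfl, rfl, h⟩ := h
  have key : ∀ k : ℕ, ∀ hk : k ≤ l, ∃ D, IsErrorState c (D + E) (φ ⟨k, by omega⟩) ∧
      hammingNorm D ≤ ∑ j with j.val < k, (F j).count := by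
    intro k
    induction k with
    | zero => intro _; exact ⟨0, by simpa using hψ, by simp⟩
    | succ k ih =>
      intro hk
      obtain ⟨D, hD, hDw⟩ := ih (by omega)
      obtain ⟨D', hD', hDw', -⟩ := (h ⟨k, by omega⟩).exists_error hc hD
      refine ⟨D' + D, by rw [add_assoc]; exact hD', ?_⟩
      have hins : (Finset.univ.filter fun j : Fin l => j.val < k + 1) =
          insert ⟨k, by omega⟩ (Finset.univ.filter fun j : Fin l => j.val < k) := by
        ext j
        simp only [Finset.mem_filter, Finset.mem_univ, true_and, Finset.mem_insert, Fin.ext_iff]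
        omega
      rw [hins, Finset.sum_insert (by simp)]
      exact (hammingNorm_add_le _ _).trans (add_le_add hDw' hDw)
  obtain ⟨D, hD, hDw⟩ := key l le_rfl
  refine ⟨D + E, hD, ?_, ?_⟩
  · rw [add_assoc, pauliString_add_self, add_zero]
    simpa using hDw
  · intro h0
    funext j
    -- Without faults no error has been added before generator `j`, so its bit is read off the
    -- initial error `E`.
    obtain ⟨D, hD, hDw⟩ := key j.val j.2.le
    have h1 : ∀ i, (F i).count = 0 := fun i => Finset.sum_eq_zero_iff.1 h0 i (Finset.mem_univ i)
    simp only [h1, Finset.sum_const_zero, Nat.le_zero, hammingNorm_eq_zero] at hDw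
    rw [hDw, zero_add] at hD
    obtain ⟨_, _, _, h2⟩ := (h j).exists_error hc hD
    exact h2 (h1 j)

/-! ### The Pauli error along an execution -/

namespace Execution

variable {C : StabilizerCode n l} {rule : AdaptiveRule l} (e : Execution C rule)

/-- The number of faults in round number `i + 1`. -/
def roundFaults (i : ℕ) : ℕ := ∑ j, (e.fault i j).count

theorem exists_errors {c : QState (Fin n)} (hc : IsCodeword C c) {E : PauliString (Fin n)}
    (hE : e.input = pauliOp E *ᵥ c) :
    ∃ err : ℕ → PauliString (Fin n), err 0 = E ∧
      (∀ i ≤ e.rounds, IsErrorState c (err i) (e.state i)) ∧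
      ∀ i < e.rounds, hammingNorm (err (i + 1) + err i) ≤ e.roundFaults i ∧
        (e.roundFaults i = 0 → e.syn i = syndromeOf C (err i)) := by
  -- The premises stand under the existential so that `choose` yields a total function, to be
  -- iterated; outside the execution its value is the arbitrary `0`.
  have step : ∀ i E, ∃ E', i < e.rounds → IsErrorState c E (e.state i) →
      IsErrorState c E' (e.state (i + 1)) ∧ hammingNorm (E' + E) ≤ e.roundFaults i ∧
        (e.roundFaults i = 0 → e.syn i = syndromeOf C E) := by
    intro i E
    by_cases h : i < e.rounds ∧ IsErrorState c E (e.state i)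
    · obtain ⟨E', h'⟩ := (e.measured i h.1).exists_error hc h.2
      exact ⟨E', fun _ _ => h'⟩
    · exact ⟨0, fun h1 h2 => absurd ⟨h1, h2⟩ h⟩
  choose next hnext using step
  let err : ℕ → PauliString (Fin n) := fun i => Nat.rec E next i
  have herr : ∀ i ≤ e.rounds, IsErrorState c (err i) (e.state i) := by
    intro i
    induction i with
    | zero => intro _; exact ⟨1, one_ne_zero, by rw [one_smul]; exact hE⟩
    | succ i ih => intro hi; exact (hnext i (err i) (by omega) (ih (by omega))).1
  exact ⟨err, rfl, herr, fun i hi => (hnext i (err i) hi (herr i hi.le)).2⟩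

end Execution

theorem hammingNorm_add_le_sum {err : ℕ → PauliString (Fin n)} {f : ℕ → ℕ} {i j : ℕ} (hij : i ≤ j)
    (h : ∀ k < j, hammingNorm (err (k + 1) + err k) ≤ f k) :
    hammingNorm (err j + err i) ≤ ∑ k ∈ Finset.Ico i j, f k := by
  induction j, hij using Nat.le_induction with
  | base => simp [pauliString_add_self]
  | succ j hij ih =>
    rw [Finset.sum_Ico_succ_top hij]
    have h1 : err (j + 1) + err i = (err (j + 1) + err j) + (err j + err i) := by
      rw [add_assoc, ← add_assoc (err j), pauliString_add_self, zero_add]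
    rw [h1, add_comm (∑ _ ∈ _, _)]
    exact (hammingNorm_add_le _ _).trans
      (add_le_add (h j (by omega)) (ih fun k hk => h k (by omega)))

theorem Execution.numFaults_eq {C : StabilizerCode n l} {rule : AdaptiveRule l}
    (e : Execution C rule) : e.numFaults =
      (∑ i ∈ Finset.range e.rounds, e.roundFaults i) + hammingNorm e.recoveryFault := rfl

/-- If the chosen syndrome is correct at some time, then the output error consists of later faults
only. -/
theorem Execution.output_of_chosen_eq {C : StabilizerCode n l} {rule : AdaptiveRule l}
    (e : Execution C rule) {c : QState (Fin n)} (hc : IsCodeword C c)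
    {err : ℕ → PauliString (Fin n)} (herr : IsErrorState c (err e.rounds) (e.state e.rounds))
    (hstep : ∀ i < e.rounds, hammingNorm (err (i + 1) + err i) ≤ e.roundFaults i)
    (hw : 2 * (hammingNorm (err 0) + e.numFaults) < distance C) {i : ℕ} (hi : i ≤ e.rounds)
    (hch : e.chosen = syndromeOf C (err i)) :
    ∃ E', hammingNorm E' ≤ e.numFaults ∧ IsErrorState c E' e.output := by
  have hnf := e.numFaults_eq
  have h1 := hammingNorm_add_le_sum (Nat.zero_le i) fun k hk => hstep k (hk.trans_le hi)
  have h2 := hammingNorm_add_le_sum hi hstep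
  have h3 := Finset.sum_range_add_sum_Ico e.roundFaults hi
  rw [Nat.Ico_zero_eq_range] at h1
  have h4 : hammingNorm (err i) ≤ hammingNorm (err i + err 0) + hammingNorm (err 0) := by
    have := hammingNorm_add_le (err i + err 0) (err 0)
    rwa [add_assoc, pauliString_add_self, add_zero] at this
  have hR := e.isRecovery
  rw [hch] at hR
  refine ⟨e.recoveryFault + (err e.rounds + err i), ?_, ?_⟩
  · have := hammingNorm_add_le e.recoveryFault (err e.rounds + err i)
    omega
  -- The recovery equals `err i` up to a stabilizer, so it cancels the error present at time `i`;
  -- this error has weight at most `r + s`, below half the distance.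
  · refine IsErrorState.of_add_mem_span hc ?_ (recovery_add_mem_span hR (by omega))
    have h5 := (herr.pauliOp_mulVec e.recovery).pauliOp_mulVec e.recoveryFault
    have h6 : e.recoveryFault + (err e.rounds + err i) + (e.recovery + err i) =
        e.recoveryFault + (e.recovery + err e.rounds) := by
      have : e.recoveryFault + (err e.rounds + err i) + (e.recovery + err i) =
        e.recoveryFault + (e.recovery + err e.rounds) + (err i + err i) := by abel
      rw [this, pauliString_add_self, add_zero]
    rw [h6]
    exact h5

/-! ### The adaptive weak decoder in terms of difference strings -/

theorem getElem?_history {s : ℕ → Syndrome l} {m p : ℕ} {σ : Syndrome l} :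
    (history s m)[p]? = some σ ↔ p < m ∧ s p = σ := by
  rw [history, List.getElem?_map, Option.map_eq_some_iff]
  constructor
  · rintro ⟨a, ha, rfl⟩
    obtain ⟨h, rfl⟩ := List.getElem?_eq_some_iff.1 ha
    exact ⟨by simpa using h, by simp⟩
  · rintro ⟨h, rfl⟩
    exact ⟨p, by simp [h], rfl⟩

theorem diffVector_history (s : ℕ → Syndrome l) (m : ℕ) :
    diffVector (history s (m + 1)) = diffString s m := by
  apply List.ext_getElem
  · simp [diffVector, history]
  · intro i h1 h2
    simp [diffVector, history, diffString]

theorem tail_diffString {α : Type*} [DecidableEq α] (S : ℕ → α) (N : ℕ) :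
    (diffString S N).tail = diffString (fun i => S (i + 1)) (N - 1) := by
  apply List.ext_getElem
  · simp
  · intro i h1 h2
    simp [diffString]

/-- The syndromes of successive rounds preceded by the zero syndrome. -/
def withZero (s : ℕ → Syndrome l) : ℕ → Syndrome l
  | 0 => 0
  | i + 1 => s i

theorem false_cons_diffString {s : ℕ → Syndrome l} (hs : s 0 = 0) (N : ℕ) :
    false :: diffString s N = diffString (withZero s) (N + 1) := by
  apply List.ext_getElem
  · simp
  · intro i h1 h2
    rcases i with _ | i <;> simp [diffString, withZero, hs]

theorem UsableZeros.lt_length {t γ p : ℕ} {w u v : List Bool} (h : UsableZeros t w u γ v)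
    (hp : p < u.length + γ) : p < w.length := by
  rw [h.1]; simp; omega

theorem weakRule_history_of_ne {s : ℕ → Syndrome l} (hs : s 0 ≠ 0) (t m : ℕ) (σ : Syndrome l) :
    weakRule l t (history s (m + 1)) σ ↔
      (∃ u γ v p, UsableZeros (t - 1) (diffString (fun i => s (i + 1)) (m - 1)) u γ v ∧
        u.length ≤ p ∧ p < u.length + γ ∧ s (p + 1) = σ) ∨
      (numPairs (diffString (fun i => s (i + 1)) (m - 1)) = t - 1 ∧ s m = σ) := by
  have hhead : (history s (m + 1)).head? = some (s 0) := by
    simp [history, List.range_succ_eq_map]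
  have hlast : (history s (m + 1)).getLast? = some (s m) := by
    simp [history, List.range_succ]
  simp only [weakRule, diffVector_history, tail_diffString, hhead, hlast, Option.mem_def,
    Option.some.injEq, exists_eq_left', hs, ne_eq, not_false_eq_true, true_and, false_and,
    or_false, getElem?_history]
  refine or_congr ?_ Iff.rfl
  constructor
  · rintro ⟨u, γ, v, p, h, h1, h2, -, h3⟩
    exact ⟨u, γ, v, p, h, h1, h2, h3⟩
  · rintro ⟨u, γ, v, p, h, h1, h2, h3⟩
    have := h.lt_length h2
    rw [length_diffString] at this
    exact ⟨u, γ, v, p, h, h1, h2, by omega, h3⟩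

theorem weakRule_history_of_eq {s : ℕ → Syndrome l} (hs : s 0 = 0) (t m : ℕ) (σ : Syndrome l) :
    weakRule l t (history s (m + 1)) σ ↔
      (∃ u γ v p, UsableZeros t (diffString (withZero s) (m + 1)) u γ v ∧
        u.length ≤ p ∧ p < u.length + γ ∧ s p = σ) ∨
      (numPairs (diffString (withZero s) (m + 1)) = t ∧ s m = σ) := by
  have hhead : (history s (m + 1)).head? = some (s 0) := by
    simp [history, List.range_succ_eq_map]
  have hlast : (history s (m + 1)).getLast? = some (s m) := by
    simp [history, List.range_succ]
  simp only [weakRule, diffVector_history, false_cons_diffString hs, hhead, hlast, Option.mem_def,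
    Option.some.injEq, exists_eq_left', hs, ne_eq, not_true_eq_false, true_and, false_and,
    false_or, getElem?_history]
  refine or_congr ?_ Iff.rfl
  constructor
  · rintro ⟨u, γ, v, p, h, h1, h2, -, h3⟩
    exact ⟨u, γ, v, p, h, h1, h2, h3⟩
  · rintro ⟨u, γ, v, p, h, h1, h2, h3⟩
    have := h.lt_length h2
    rw [length_diffString] at this
    exact ⟨u, γ, v, p, h, h1, h2, by omega, h3⟩

/-! ### The number of rounds -/

/-- A difference string as long as `h` demands has usable zeros or enough substrings `11`. -/
theorem exists_usableZeros_or_numPairs {α : Type*} [DecidableEq α] (S : ℕ → α) {T N : ℕ}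
    (hT : 0 < T) (h : (T + 3) ^ 2 < 4 * (N + 3)) :
    (∃ u γ v, UsableZeros T (diffString S N) u γ v) ∨
      ∃ k, 0 < k ∧ k ≤ N ∧ numPairs (diffString S k) = T := by
  by_contra hcon
  push Not at hcon
  obtain ⟨h1, h2⟩ := hcon
  have h3 := length_lt_of_not_usableZeros h1 (numPairs_diffString_lt S N hT fun k hk => by
    rcases Nat.eq_zero_or_pos k with rfl | hk0
    · simpa [diffString] using hT.ne
    · exact h2 k hk0 hk)
  rw [length_diffString] at h3
  omega

/-- After `M` rounds the string has `M - 2` comparisons and the budget is `T = t - 1`. -/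
theorem stopsWithin_of_ne {s : ℕ → Syndrome l} (hs : s 0 ≠ 0) {t M : ℕ} (ht : 2 ≤ t)
    (hM : (t + 2) ^ 2 < 4 * (M + 1)) : StopsWithin (weakRule l t) s M := by
  obtain ⟨t, rfl⟩ := Nat.exists_eq_add_of_le' (show 1 ≤ t by omega)
  have hM2 : 2 ≤ M := by nlinarith
  obtain ⟨M, rfl⟩ := Nat.exists_eq_add_of_le' hM2
  rcases exists_usableZeros_or_numPairs (fun i => s (i + 1)) (T := t) (N := M) (by omega)
    (by simpa [add_assoc] using hM) with ⟨u, γ, v, h⟩ | ⟨k, hk, hkM, h⟩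
  · refine ⟨M + 2, by omega, le_rfl, s (u.length + 1), ?_⟩
    exact (weakRule_history_of_ne hs _ (M + 1) _).2
      (Or.inl ⟨u, γ, v, u.length, h, le_rfl, Nat.lt_add_of_pos_right h.2.1, rfl⟩)
  · refine ⟨k + 2, by omega, by omega, s (k + 1), ?_⟩
    exact (weakRule_history_of_ne hs _ (k + 1) _).2 (Or.inr ⟨h, rfl⟩)

/-- The added zero makes the string as long as the number `M` of rounds, and the budget is `T = t`.
-/
theorem stopsWithin_of_eq {s : ℕ → Syndrome l} (hs : s 0 = 0) {t M : ℕ} (ht : 2 ≤ t)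
    (hM : (t + 3) ^ 2 < 4 * (M + 3)) : StopsWithin (weakRule l t) s M := by
  have hM1 : 1 ≤ M := by nlinarith
  obtain ⟨M, rfl⟩ := Nat.exists_eq_add_of_le' hM1
  rcases exists_usableZeros_or_numPairs (withZero s) (by omega) hM with
    ⟨u, γ, v, h⟩ | ⟨k, hk, hkM, h⟩
  · refine ⟨M + 1, by omega, le_rfl, s u.length, ?_⟩
    exact (weakRule_history_of_eq hs _ M _).2
      (Or.inl ⟨u, γ, v, u.length, h, le_rfl, Nat.lt_add_of_pos_right h.2.1, rfl⟩)
  · obtain ⟨k, rfl⟩ := Nat.exists_eq_add_of_le' (show 1 ≤ k from hk)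
    refine ⟨k + 1, by omega, by omega, s k, ?_⟩
    exact (weakRule_history_of_eq hs _ k _).2 (Or.inr ⟨h, rfl⟩)

/-! ### Fault tolerance -/

/-- With at most `t` faults and input errors, the adaptive weak decoder chooses a syndrome which
was correct at some time. -/
theorem exists_chosen_eq {C : StabilizerCode n l} {t : ℕ} (ht : 2 ≤ t)
    (e : Execution C (weakRule l t)) (err : ℕ → PauliString (Fin n))
    (herr : ∀ i < e.rounds, hammingNorm (err (i + 1) + err i) ≤ e.roundFaults i ∧
      (e.roundFaults i = 0 → e.syn i = syndromeOf C (err i)))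
    (hw : hammingNorm (err 0) + ∑ i ∈ Finset.range e.rounds, e.roundFaults i ≤ t) :
    ∃ i ≤ e.rounds, e.chosen = syndromeOf C (err i) := by
  have hgood : ∀ i < e.rounds, e.roundFaults i = 0 →
      e.syn i = syndromeOf C (err i) ∧ syndromeOf C (err (i + 1)) = syndromeOf C (err i) := by
    intro i hi h0
    refine ⟨(herr i hi).2 h0, ?_⟩
    have h1 : hammingNorm (err (i + 1) + err i) = 0 := Nat.le_zero.1 (h0 ▸ (herr i hi).1)
    rw [eq_of_hammingNorm_add_eq_zero h1]
  have hrule := e.stopped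
  have hnot := e.not_stopped
  obtain ⟨m, hm⟩ : ∃ m, e.rounds = m + 1 := by
    rcases h : e.rounds with _ | m
    · rw [h] at hrule
      simp [weakRule, history] at hrule
    · exact ⟨m, rfl⟩
  rw [hm] at hrule hnot hgood hw ⊢
  by_cases hs : e.syn 0 = 0
  · rw [weakRule_history_of_eq hs] at hrule
    -- Index `0` is a fictitious round reporting the zero syndrome, with the weight of the input
    -- error as its number of faults. If that weight is zero, the report is correct.
    let g : ℕ → ℕ := fun j => Nat.casesOn j (hammingNorm (err 0)) e.roundFaults
    let good : ℕ → Syndrome l :=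
      fun j => Nat.casesOn j (syndromeOf C (err 0)) fun i => syndromeOf C (err i)
    have hg : ∀ j, j ≤ m + 1 → g j = 0 →
        withZero e.syn j = good j ∧ good (j + 1) = good j := by
      intro j hj h0
      rcases j with _ | j
      · have h0 : hammingNorm (err 0) = 0 := h0
        rw [hammingNorm_eq_zero] at h0
        refine ⟨?_, rfl⟩
        change 0 = syndromeOf C (err 0)
        rw [h0, syndromeOf_zero]
      · exact hgood j (by omega) h0
    have hsum : ∑ j ∈ Finset.range (m + 2), g j ≤ t := by
      rw [Finset.sum_range_succ', add_comm]; exact hw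
    have hex : ∀ j ≤ m + 1, ∃ i ≤ m + 1, good j = syndromeOf C (err i) := by
      intro j hj
      rcases j with _ | j
      · exact ⟨0, by omega, rfl⟩
      · exact ⟨j, by omega, rfl⟩
    rcases hrule with ⟨u, γ, v, p, h, h1, h2, h3⟩ | ⟨h1, h2⟩
    · obtain ⟨h4, j, hj, h5⟩ := exists_faultless_of_usable hg hsum h h1 h2
      obtain ⟨i, hi, h6⟩ := hex j hj
      -- The chosen syndrome is the later of the two compared at `p`, hence the passage through
      -- `h4`.
      exact ⟨i, hi, by rw [← h6, ← h5, ← h4, ← h3]; rfl⟩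
    -- The protocol did not stop one round earlier, so the last round is the one that completed the
    -- `t`-th pair.
    · have hprev : numPairs (diffString (withZero e.syn) m) ≠ t := by
        rcases m with _ | m
        · simp [diffString]; omega
        · intro h
          exact hnot (m + 1) (by omega) ⟨_, (weakRule_history_of_eq hs _ m _).2 (Or.inr ⟨h, rfl⟩)⟩
      have h3 := last_faultless_of_numPairs hg hsum h1 hprev
      exact ⟨m, by omega, by rw [← h2]; exact h3⟩
  · rw [weakRule_history_of_ne hs] at hrule
    -- A nonzero first syndrome needs an input error or a fault in the first round, leaving at most
    -- `t - 1` faults for the later rounds.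
    have hfirst : 1 ≤ hammingNorm (err 0) + e.roundFaults 0 := by
      by_contra hcon
      have h0 : hammingNorm (err 0) = 0 := by omega
      rw [hammingNorm_eq_zero] at h0
      apply hs
      rw [(hgood 0 (by omega) (by omega)).1, h0, syndromeOf_zero]
    rw [Finset.sum_range_succ'] at hw
    have hsum : ∑ j ∈ Finset.range m, e.roundFaults (j + 1) ≤ t - 1 := by omega
    rcases m with _ | m
    -- After a single round the string is empty and cannot stop the protocol, because `t - 1 > 0`.
    · exfalso
      rcases hrule with ⟨u, γ, v, p, h, -, h2, -⟩ | ⟨h1, -⟩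
      · have := h.lt_length h2
        simp at this
      · simp [diffString] at h1; omega
    rw [Nat.add_sub_cancel] at hrule
    have hg : ∀ j, j ≤ m → e.roundFaults (j + 1) = 0 → e.syn (j + 1) = syndromeOf C (err (j + 1)) ∧
        syndromeOf C (err (j + 1 + 1)) = syndromeOf C (err (j + 1)) :=
      fun j hj h0 => hgood (j + 1) (by omega) h0
    rcases hrule with ⟨u, γ, v, p, h, h1, h2, h3⟩ | ⟨h1, h2⟩
    · obtain ⟨-, j, hj, h5⟩ := exists_faultless_of_usable (S := fun i => e.syn (i + 1))
        (good := fun i => syndromeOf C (err (i + 1))) hg hsum h h1 h2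
      exact ⟨j + 1, by omega, by rw [← h3]; exact h5⟩
    · rcases m with _ | m
      · simp [diffString] at h1; omega
      have hprev : numPairs (diffString (fun i => e.syn (i + 1)) m) ≠ t - 1 := fun h =>
        hnot (m + 2) (by omega)
          ⟨_, (weakRule_history_of_ne hs _ (m + 1) _).2 (Or.inr ⟨h, rfl⟩)⟩
      have h3 := last_faultless_of_numPairs (S := fun i => e.syn (i + 1))
        (good := fun i => syndromeOf C (err (i + 1))) hg hsum h1 hprev
      exact ⟨m + 2, by omega, by rw [← h2]; exact h3⟩

theorem exists_output_error {C : StabilizerCode n l} {t : ℕ} (ht : 2 ≤ t)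
    (hd : 2 * t < distance C) (e : Execution C (weakRule l t)) {c : QState (Fin n)}
    {E : PauliString (Fin n)} (hc : IsCodeword C c) (hE : e.input = pauliOp E *ᵥ c)
    (hw : hammingNorm E + e.numFaults ≤ t) :
    ∃ E', hammingNorm E' ≤ e.numFaults ∧ IsErrorState c E' e.output := by
  obtain ⟨err, rfl, hstate, hstep⟩ := e.exists_errors hc hE
  have hnf := e.numFaults_eq
  obtain ⟨i, hi, hch⟩ := exists_chosen_eq ht e err hstep (by omega)
  exact e.output_of_chosen_eq hc (hstate _ le_rfl) (fun i hi => (hstep i hi).1) (by omega) hi hch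

/-- Input and output are the same codeword with errors of weight at most `t`, below half the
distance, so both decode to multiples of it. -/
theorem weaklyFaultTolerant_weakRule (C : StabilizerCode n l) {t : ℕ} (ht : 2 ≤ t)
    (hd : 2 * t < distance C) : WeaklyFaultTolerant C (weakRule l t) t := by
  constructor
  · intro e c E hc hE hw φ φ' hφ hφ'
    obtain ⟨E', hE', hout⟩ := exists_output_error ht hd e hc hE hw
    obtain ⟨a, ha, rfl⟩ := hφ.isErrorState hc (E := E)
      ⟨1, one_ne_zero, by rw [one_smul, hE]⟩ (by omega)
    obtain ⟨a', ha', rfl⟩ := hφ'.isErrorState hc hout (by omega)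
    exact ⟨a' * a⁻¹, mul_ne_zero ha' (inv_ne_zero ha), by
      rw [smul_smul, mul_assoc, inv_mul_cancel₀ ha, mul_one]⟩
  · intro e c E hc hE hw
    obtain ⟨E', hE', a, ha, hout⟩ := exists_output_error ht hd e hc hE hw
    exact ⟨a • c, E', hc.smul ha, hE', by rw [Matrix.mulVec_smul]; exact hout⟩

end ShorEC

/-! ### The round bounds by parity of `t` -/

theorem theorem3 {n l : ℕ} (C : ShorEC.StabilizerCode n l) (d t : ℕ)
    (hd : ShorEC.distance C = d) (hd5 : 5 ≤ d) (ht : t = (d - 1) / 2) :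
    ShorEC.WeaklyFaultTolerant C (ShorEC.weakRule l t) t ∧
    ∀ s : ℕ → ShorEC.Syndrome l,
      (s 0 ≠ 0 →
        (Even t → ShorEC.StopsWithin (ShorEC.weakRule l t) s (((t + 2) / 2) ^ 2)) ∧
        (Odd t →
          ShorEC.StopsWithin (ShorEC.weakRule l t) s (((t + 1) / 2) * ((t + 3) / 2)))) ∧
      (s 0 = 0 →
        (Even t →
          ShorEC.StopsWithin (ShorEC.weakRule l t) s (((t + 2) / 2) * ((t + 4) / 2) - 2)) ∧
        (Odd t →
          ShorEC.StopsWithin (ShorEC.weakRule l t) s (((t + 3) / 2) ^ 2 - 2))) := by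
  -- Distance at least five ensures that the smaller budget `t - 1` is positive.
  have ht2 : 2 ≤ t := by omega
  refine ⟨ShorEC.weaklyFaultTolerant_weakRule C ht2 (by omega), fun s =>
    ⟨fun hs => ⟨?_, ?_⟩, fun hs => ⟨?_, ?_⟩⟩⟩
  · rintro ⟨k, hk⟩
    apply ShorEC.stopsWithin_of_ne hs ht2
    obtain rfl : t = 2 * k := by omega
    rw [show (2 * k + 2) / 2 = k + 1 by omega]
    nlinarith
  · rintro ⟨k, rfl⟩
    apply ShorEC.stopsWithin_of_ne hs ht2
    rw [show (2 * k + 1 + 1) / 2 = k + 1 by omega, show (2 * k + 1 + 3) / 2 = k + 2 by omega]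
    nlinarith
  · rintro ⟨k, hk⟩
    apply ShorEC.stopsWithin_of_eq hs ht2
    obtain rfl : t = 2 * k := by omega
    rw [show (2 * k + 2) / 2 = k + 1 by omega, show (2 * k + 4) / 2 = k + 2 by omega]
    have : 2 ≤ (k + 1) * (k + 2) := by nlinarith
    zify [this]
    nlinarith
  · rintro ⟨k, rfl⟩
    apply ShorEC.stopsWithin_of_eq hs ht2
    rw [show (2 * k + 1 + 3) / 2 = k + 2 by omega]
    have : 2 ≤ (k + 2) ^ 2 := by nlinarith
    zify [this]
    nlinarith
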